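/- Let $m,k,l$ be integers with $k\ge 1$ and $1\le l\le m-k-1$, and let $c_1\ne 0$ be a real constant. Let $Cl_m$ be the real Clifford algebra generated by $\mathbb R^m$ with $x^2=-\|x\|^2$, let $e_1,\dots,e_m$ be the standard basis of $\mathbb R^m$, let $\mathbb Z^l=\mathbb Ze_1+\cdots+\mathbb Ze_l\subset\mathbb R^m$, and let $\pi_l:\mathbb R^m\to C_l=\mathbb R^m/\mathbb Z^l$ be the projection onto the $l$-cylinder. Put $D_x=\sum_i e_i\partial_{x_i}$, $\Delta_x=\sum_i\partial_{x_i}^2$, $\langle u,D_x\rangle=\sum_i u_i\partial_{x_i}$, $\langle D_u,D_x\rangle=\sum_i\partial_{u_i}\partial_{x_i}$. For $Cl_m$-valued functions of $(x,u)$, $u\in\mathbb R^m$, let, for $k=2n$, $$\mathcal D_{1,2n}=\Delta_x^n-\frac{4n}{m+2n-2}\langle u,D_x\rangle\langle D_u,D_x\rangle\Delta_x^{n-1},$$ and, for $k=2n-1$ (the last term being absent when $n=1$), $$\mathcal D_{1,2n-1}=D_x\Delta_x^{n-1}-\frac{2}{m+2n-2}\,u\,\langle D_u,D_x\rangle\Delta_x^{n-1}-\frac{4n-4}{m+2n-2}\langle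 u,D_x\rangle\langle D_u,D_x\rangle\Delta_x^{n-2}D_x .$$ Let $\mathcal D_{1,k}^{C_l}$ be the operator given by the same formula for functions on $C_l\times\mathbb R^m$, where $\partial_{x_i}$ acts on a function on $C_l$ by differentiating its lift to $\mathbb R^m$. Let $\mathcal P_k$ be the space of $Cl_m$-valued homogeneous polynomials of degree $1$ in $u\in\mathbb R^m$ that are harmonic if $k$ is even and left monogenic ($D_uf=0$) if $k$ is odd. Then $\mathcal P_k$ has a unique reproducing kernel $Z_1(u,v)$, that is, $Z_1(\cdot,v)\in\mathcal P_k$ and $f(v)=\int_{S^{m-1}}\overline{Z_1(u,v)}f(u)\,dS(u)$ for all $f\in\mathcal P_k$ and $v\in\mathbb R^m$, where the bar is Clifford conjugation. Define, for $x\neq0$, $$E_{1,k}(x,u,v)=c_1G_k(x)Z_1\Big(\frac{xux}{\|x\|^2},v\Big),\qquad G_{2n}(x)=\frac1{\|x\|^{m-2n}},\quad G_{2n-1}(x)=\frac{x}{\|x\|^{m-2n+2}} .$$ For all $u,v\in\mathbb R^m$ the following hold. (a) The series $$cot_{l,1,k}(x,u,v)=\sum_{(m_1,\dots,m_l)\in\mathbb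 Z^l}E_{1,k}(x+m_1e_1+\cdots+m_le_l,u,v)$$ converges normally on $\mathbb R^m\setminus\mathbb Z^l$ (on each compact subset it is dominated in norm by a convergent series of constants), hence locally uniformly there. (b) Its sum is $l$-fold periodic: $cot_{l,1,k}(x+\mathbf m,u,v)=cot_{l,1,k}(x,u,v)$ for all $\mathbf m\in\mathbb Z^l$. It is $C^\infty$ in $(x,u)\in(\mathbb R^m\setminus\mathbb Z^l)\times\mathbb R^m$, it belongs to $\mathcal P_k$ as a function of $u$, and $\mathcal D_{1,k}\,cot_{l,1,k}(x,u,v)=0$ for $x\in\mathbb R^m\setminus\mathbb Z^l$. (c) The formula $cot'_{l,1,k}(\pi_l(x),\pi_l(y),u,v)=cot_{l,1,k}(x-y,u,v)$ gives a well-defined function on $(C_l\times C_l)\setminus\{(x',x'):x'\in C_l\}$ (the series at $x-y$ converges whenever $\pi_l(x)\ne\pi_l(y)$), and, with the operator acting in $(x',u)$, $$\mathcal D^{C_l}_{1,k}\,cot'_{l,1,k}(x',y',u,v)=0\qquad(x'\ne y').$$ -/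

import Mathlib

open scoped ContDiff InnerProductSpace

noncomputable section

namespace Cylinder

/-- Euclidean space `ℝ^m`. -/
abbrev E (m : ℕ) := EuclideanSpace ℝ (Fin m)

/-- The standard basis vector `e_i` of `ℝ^m`. -/
def e {m : ℕ} (i : Fin m) : E m := EuclideanSpace.single i 1

/-! ### The Clifford algebra `Cl_m` -/

/-- The quadratic form `x ↦ -‖x‖²` on `ℝ^m`. -/
def negSq (m : ℕ) : QuadraticForm ℝ (E m) := -LinearMap.BilinMap.toQuadraticMap (innerₗ (E m))

theorem negSq_apply {m : ℕ} (x : E m) : negSq m x = -‖x‖ ^ 2 := by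
  simp [negSq, LinearMap.BilinMap.toQuadraticMap_apply]

/-- The real Clifford algebra `Cl_m`, generated by `ℝ^m` with the relation `x² = -‖x‖²`. -/
abbrev Cl (m : ℕ) := CliffordAlgebra (negSq m)

/-- The inclusion `ℝ^m ⊆ Cl_m`. -/
abbrev vec {m : ℕ} (x : E m) : Cl m := CliffordAlgebra.ι (negSq m) x

theorem vec_mul_self {m : ℕ} (x : E m) : vec x * vec x = algebraMap ℝ (Cl m) (-‖x‖ ^ 2) := by
  rw [vec, CliffordAlgebra.ι_sq_scalar, negSq_apply]

instance finite_exteriorAlgebra (m : ℕ) : Module.Finite ℝ (ExteriorAlgebra ℝ (E m)) := by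
  have hbot : ∀ i : ℕ, m < i → (⋀[ℝ]^i (E m)) = ⊥ := by
    intro i hi
    have h := exteriorPower.finrank_eq (R := ℝ) (M := E m) i
    rw [finrank_euclideanSpace_fin, Nat.choose_eq_zero_of_lt hi] at h
    exact Submodule.finrank_eq_zero.mp h
  have htop : (⨆ i : Fin (m + 1), (⋀[ℝ]^(i : ℕ) (E m))) = ⊤ := by
    have h := (DirectSum.Decomposition.isInternal
      (fun i : ℕ => ⋀[ℝ]^i (E m))).submodule_iSup_eq_top
    rw [eq_top_iff, ← h]
    refine iSup_le fun i => ?_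
    by_cases hi : i < m + 1
    · exact le_iSup (fun i : Fin (m + 1) => (⋀[ℝ]^(i : ℕ) (E m))) ⟨i, hi⟩
    · rw [hbot i (by omega)]
      exact bot_le
  refine ⟨?_⟩
  rw [← htop]
  exact Submodule.fg_iSup _ fun i => Module.Finite.iff_fg.mp inferInstance

instance finite_cl (m : ℕ) : Module.Finite ℝ (Cl m) :=
  Module.Finite.equiv (CliffordAlgebra.equivExterior (negSq m)).symm

/-- `Cl_m` is a finite-dimensional real vector space, so all its norms are equivalent; we fix the
sup norm of the coordinates in some basis.  It is used only for notions that do not depend on the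
choice of the norm (convergence, derivatives, integrals). -/
instance normedAddCommGroupCl (m : ℕ) : NormedAddCommGroup (Cl m) :=
  NormedAddCommGroup.induced (Cl m) (Fin (Module.finrank ℝ (Cl m)) → ℝ)
    (Module.finBasis ℝ (Cl m)).equivFun (Module.finBasis ℝ (Cl m)).equivFun.injective

instance normedSpaceCl (m : ℕ) : NormedSpace ℝ (Cl m) :=
  NormedSpace.induced ℝ (Cl m) (Fin (Module.finrank ℝ (Cl m)) → ℝ)
    (Module.finBasis ℝ (Cl m)).equivFun

/-! ### The cylinder `C_l = ℝ^m / ℤ^l` -/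

/-- `(n_1, …, n_l) ↦ n_1 e_1 + ⋯ + n_l e_l` (used for `l ≤ m`). -/
def latticeVec (m l : ℕ) : (Fin l → ℤ) →+ E m where
  toFun n := WithLp.toLp 2 fun j : Fin m => if h : (j : ℕ) < l then (n ⟨j, h⟩ : ℝ) else 0
  map_zero' := by ext j; simp
  map_add' a b := by
    ext j
    by_cases h : (j : ℕ) < l <;> simp [h]

/-- The lattice `ℤ^l = ℤ e_1 + ⋯ + ℤ e_l ⊆ ℝ^m`. -/
def lattice (m l : ℕ) : AddSubgroup (E m) := (latticeVec m l).range

/-- The `l`-cylinder `C_l = ℝ^m / ℤ^l`. -/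
abbrev Cyl (m l : ℕ) := E m ⧸ lattice m l

/-- The projection `π_l : ℝ^m → C_l`. -/
abbrev proj (m l : ℕ) (x : E m) : Cyl m l := QuotientAddGroup.mk x

/-- The function on `C_l` induced by an `l`-fold periodic function on `ℝ^m`. -/
def cylLift {m l : ℕ} {α : Type*} (g : E m → α)
    (hg : ∀ (n : Fin l → ℤ) (x : E m), g (x + latticeVec m l n) = g x) : Cyl m l → α :=
  Quotient.lift g (by
    intro a b hab
    obtain ⟨n, hn⟩ := QuotientAddGroup.leftRel_apply.mp hab
    have hb : b = a + latticeVec m l n := by rw [hn]; abel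
    rw [hb, hg])

/-! ### Differential operators

The operators are written once, for functions `F(x, u)` with `x` in a space `X` (which is `ℝ^m`
or `C_l`) that carries operators `P i`, the partial derivatives with respect to `x_i`. -/

/-- The partial derivative `∂_{x_i}` on `ℝ^m`. -/
def partialE {m : ℕ} (i : Fin m) (g : E m → Cl m) (x : E m) : Cl m := lineDeriv ℝ g x (e i)

theorem partialE_periodic {m l : ℕ} (i : Fin m) (g : Cyl m l → Cl m) (n : Fin l → ℤ) (x : E m) :
    partialE i (fun z => g (proj m l z)) (x + latticeVec m l n) =
      partialE i (fun z => g (proj m l z)) x := by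
  have h : ∀ z : E m, proj m l (z + latticeVec m l n) = proj m l z := fun z =>
    QuotientAddGroup.mk_add_of_mem z ⟨n, rfl⟩
  simp only [partialE, lineDeriv, add_right_comm x (latticeVec m l n), h]

/-- The projection of `∂_{x_i}` to `C_l`: it acts on a function on `C_l` by differentiating its
periodic lift to `ℝ^m`. -/
def partialCyl {m l : ℕ} (i : Fin m) (g : Cyl m l → Cl m) : Cyl m l → Cl m :=
  cylLift (partialE i fun z => g (proj m l z)) (partialE_periodic i g)

section Operators

variable {m : ℕ} {X : Type} (P : Fin m → (X → Cl m) → X → Cl m)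

/-- `∂_{x_i}` on functions of `(x, u)`. -/
def dX (i : Fin m) (F : X → E m → Cl m) : X → E m → Cl m :=
  fun x u => P i (fun z => F z u) x

/-- `∂_{u_i}` on functions of `(x, u)`. -/
def dU (i : Fin m) (F : X → E m → Cl m) : X → E m → Cl m :=
  fun x u => partialE i (F x) u

/-- The Dirac operator `D_x = ∑ e_i ∂_{x_i}`. -/
def diracX (F : X → E m → Cl m) : X → E m → Cl m :=
  fun x u => ∑ i, vec (e i) * dX P i F x u

/-- The Laplace operator `Δ_x = ∑ ∂_{x_i}²`. -/
def laplaceX (F : X → E m → Cl m) : X → E m → Cl m :=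
  fun x u => ∑ i, dX P i (dX P i F) x u

/-- `⟨u, D_x⟩ = ∑ u_i ∂_{x_i}`. -/
def uDX (F : X → E m → Cl m) : X → E m → Cl m :=
  fun x u => ∑ i, u i • dX P i F x u

/-- `⟨D_u, D_x⟩ = ∑ ∂_{u_i} ∂_{x_i}`. -/
def dUdX (F : X → E m → Cl m) : X → E m → Cl m :=
  fun x u => ∑ i, dU i (dX P i F) x u

/-- The bosonic operator of order `2n`, `n ≥ 1`:
`Δ_x^n - 4n/(m+2n-2) ⟨u, D_x⟩ ⟨D_u, D_x⟩ Δ_x^{n-1}`. -/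
def bosonic (n : ℕ) (F : X → E m → Cl m) : X → E m → Cl m :=
  fun x u => (laplaceX P)^[n] F x u
    - (4 * n / (m + 2 * n - 2) : ℝ) • uDX P (dUdX P ((laplaceX P)^[n - 1] F)) x u

/-- The fermionic operator of order `2n-1`, `n ≥ 1`:
`D_x Δ_x^{n-1} - 2/(m+2n-2) u ⟨D_u, D_x⟩ Δ_x^{n-1}
  - (4n-4)/(m+2n-2) ⟨u, D_x⟩ ⟨D_u, D_x⟩ Δ_x^{n-2} D_x`.
For `n = 1` the coefficient of the last term is zero, so that term is absent. -/
def fermionic (n : ℕ) (F : X → E m → Cl m) : X → E m → Cl m :=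
  fun x u => diracX P ((laplaceX P)^[n - 1] F) x u
    - (2 / (m + 2 * n - 2) : ℝ) • (vec u * dUdX P ((laplaceX P)^[n - 1] F) x u)
    - ((4 * n - 4) / (m + 2 * n - 2) : ℝ) •
        uDX P (dUdX P ((laplaceX P)^[n - 2] (diracX P F))) x u

/-- The operator `𝒟_{1,k}`, `k ≥ 1`: bosonic with `k = 2n`, or fermionic with `k = 2n-1`. -/
def higherSpin (k : ℕ) (F : X → E m → Cl m) : X → E m → Cl m :=
  if Even k then bosonic P (k / 2) F else fermionic P ((k + 1) / 2) F

end Operators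

/-- `𝒟_{1,k}` on `ℝ^m`. -/
def opE (m k : ℕ) : (E m → E m → Cl m) → E m → E m → Cl m := higherSpin partialE k

/-- `𝒟_{1,k}^{C_l}` on the cylinder `C_l`: the same expression, with the projections of the
derivatives to `C_l`. -/
def opCyl (m k l : ℕ) : (Cyl m l → E m → Cl m) → Cyl m l → E m → Cl m := higherSpin partialCyl k

/-! ### The reproducing kernel `Z_1` -/

/-- `f : ℝ^m → Cl_m` is a homogeneous polynomial of degree `1`. -/
def IsHomogeneousDegreeOne {m : ℕ} (f : E m → Cl m) : Prop :=
  ∃ a : Fin m → Cl m, ∀ u, f u = ∑ i, u i • a i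

/-- The `Cl_m`-valued homogeneous polynomials of degree `1` that are harmonic (`k` even), resp.
left monogenic (`k` odd). -/
def IsSpinOne {m : ℕ} (k : ℕ) (f : E m → Cl m) : Prop :=
  IsHomogeneousDegreeOne f ∧
    if Even k then ∀ u, ∑ i, partialE i (partialE i f) u = 0
    else ∀ u, ∑ i, vec (e i) * partialE i f u = 0

/-- `Z` is the reproducing kernel of the space of degree `1` polynomials above, for the inner
product `∫_{S^{m-1}} conj(f) g dS`.  Here `star` is Clifford conjugation, the anti-automorphism of
`Cl_m` with `conj(x) = -x` for `x ∈ ℝ^m`, and the measure is surface measure on the sphere. -/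
structure IsReproducingKernel (m k : ℕ) (Z : E m → E m → Cl m) : Prop where
  mem : ∀ v, IsSpinOne k fun u => Z u v
  reproducing : ∀ f : E m → Cl m, IsSpinOne k f → ∀ v,
    ∫ u : Metric.sphere (0 : E m) 1, star (Z u v) * f u
      ∂(MeasureTheory.volume : MeasureTheory.Measure (E m)).toSphere = f v

/-! ### The kernels -/

/-- The vector `x u x / ‖x‖²`, see `vec_sandwich`. -/
def sandwich {m : ℕ} (x u : E m) : E m := u - (2 * ⟪x, u⟫_ℝ / ‖x‖ ^ 2) • x

theorem vec_sandwich {m : ℕ} (x u : E m) (hx : x ≠ 0) :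
    vec (sandwich x u) = (‖x‖ ^ 2)⁻¹ • (vec x * vec u * vec x) := by
  have hn : ‖x‖ ^ 2 ≠ 0 := by simpa using hx
  have hp : QuadraticMap.polar (negSq m) x u = -(2 * ⟪x, u⟫_ℝ) := by
    simp only [QuadraticMap.polar, negSq_apply, norm_add_sq_real]
    ring
  have h := CliffordAlgebra.ι_mul_ι_mul_ι (Q := negSq m) x u
  rw [vec, vec, vec, h, hp, negSq_apply, ← LinearMap.map_smul, sandwich]
  congr 1
  ext i
  simp
  field_simp
  ring

/-- `G_k(x) = ‖x‖^{-(m-2n)}` for `k = 2n`, and `G_k(x) = x ‖x‖^{-(m-2n+2)}` for `k = 2n-1`. -/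
def G (m k : ℕ) (x : E m) : Cl m :=
  if Even k then algebraMap ℝ (Cl m) (‖x‖ ^ ((k : ℤ) - m)) else ‖x‖ ^ ((k : ℤ) - m - 1) • vec x

/-- `E_{1,k}(x,u,v) = c₁ G_k(x) Z_1(xux/‖x‖², v)`. -/
def fundSol (m k : ℕ) (c₁ : ℝ) (Z : E m → E m → Cl m) (x u v : E m) : Cl m :=
  c₁ • (G m k x * Z (sandwich x u) v)

/-- `cot_{l,1,k}(x,u,v) = ∑_{n ∈ ℤ^l} E_{1,k}(x + n_1 e_1 + ⋯ + n_l e_l, u, v)`. -/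
def cot (m k l : ℕ) (c₁ : ℝ) (Z : E m → E m → Cl m) (x u v : E m) : Cl m :=
  ∑' n : Fin l → ℤ, fundSol m k c₁ Z (x + latticeVec m l n) u v

theorem cot_periodic (m k l : ℕ) (c₁ : ℝ) (Z : E m → E m → Cl m) (u v : E m)
    (n : Fin l → ℤ) (x : E m) :
    cot m k l c₁ Z (x + latticeVec m l n) u v = cot m k l c₁ Z x u v := by
  unfold cot
  rw [← (Equiv.addLeft n).tsum_eq fun j => fundSol m k c₁ Z (x + latticeVec m l j) u v]
  simp [add_assoc]

/-- The projected kernel `cot'_{l,1,k}(x',y',u,v)` on `C_l × C_l`; only its values off the diagonal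
are meaningful. -/
def cotCyl (m k l : ℕ) (c₁ : ℝ) (Z : E m → E m → Cl m) (x' y' : Cyl m l) (u v : E m) : Cl m :=
  cylLift (fun x => cot m k l c₁ Z x u v) (cot_periodic m k l c₁ Z u v) (x' - y')

/-- Normal convergence of `∑ f_i` on `Ω`: on each compact `K ⊆ Ω` the series is dominated by a
convergent series of constants. -/
def NormallyConvergentOn {ι X V : Type*} [TopologicalSpace X] [NormedAddCommGroup V]
    (f : ι → X → V) (Ω : Set X) : Prop :=
  ∀ K ⊆ Ω, IsCompact K → ∃ M : ι → ℝ, Summable M ∧ ∀ i, ∀ x ∈ K, ‖f i x‖ ≤ M i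

end Cylinder

end

open Cylinder

noncomputable section
namespace Cylinder

/-! The terms of the series are translates of `G_k(x) w(xux/‖x‖²)`, where `w = c₁ Z_1(·, v)` is
linear. Two facts about this function carry the theorem: `𝒟_{1,k}` annihilates it off the origin,
and it is homogeneous in `x` of degree `k - m ≤ -(l+1)`.

Annihilation. Put `a = 2n - m` and `f = ‖x‖^a w(xux/‖x‖²) = ‖x‖^a w(u) - 2‖x‖^(a-2) ⟨x,u⟩ w(x)`.
Then `⟨D_u,D_x⟩ f = -(m+2n-2) ‖x‖^(a-2) w(x)`, which cancels the denominator of the bosonic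
operator, so `𝒟_{1,2n} f = Δ^(n-1) (Δ f + 4n ⟨u,D_x⟩ ‖x‖^(a-2) w(x))`. The bracket is a multiple of
`‖x‖^(2(n-1)-m) w(u)`, which `Δ^(n-1)` kills; for `n = 1` the multiple is zero
(`bosonicEnd_scalarKernel`). For `k = 2n+1` the kernel is `x f` with the same `a`. Since `w` is
monogenic, `D_x - 2/(m+2n) u ⟨D_u,D_x⟩` sends it to `-2n f`, and the whole fermionic expression is
`-2n` times the bosonic one (`fermionicEnd_spinorKernel`).

Periodization. Sums of homogeneous functions of degree at most `-(l+1)` are stable under `∂_i` and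
under left multiplication by `e_i`, and their sums over the rank `l` lattice converge normally.
Hence `periodize` is a linear map into smooth functions that commutes with both operations. As
`𝒟_{1,k}` is built from these operations alone, it commutes with `periodize` (`map_higherSpinEnd`),
and annihilation passes to the sum. On the cylinder the operator is computed on lifts, so the
statement there is a pull-back of the one on `ℝ^m`.

Reproducing kernel. Symmetries of the sphere give `∫ u_i u_j = μ δ_ij`. The kernel is therefore
`μ⁻¹⟨u,v⟩` for even `k` and `μ⁻¹(⟨u,v⟩ + uv/m)` for odd `k`. Uniqueness is the usual Hermitian
symmetry argument. -/

/-! ### The operators on abstract modules -/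

section Abstract

variable {m : ℕ} {N N' : Type*} [AddCommGroup N] [Module ℝ N] [AddCommGroup N'] [Module ℝ N']
  (D L : Fin m → Module.End ℝ N) (D' L' : Fin m → Module.End ℝ N')

/-- The Laplace operator built from endomorphisms `D i`. -/
def lapEnd : Module.End ℝ N := ∑ i, D i * D i

/-- The Dirac operator built from derivatives `D i` and Clifford multiplications `L i`. -/
def diracEnd : Module.End ℝ N := ∑ i, L i * D i

/-- The combination `∑ u_i D_i`. -/
def combEnd (u : E m) : Module.End ℝ N := ∑ i, u i • D i

/-- The divergence `∑ D_i (b e_i)`. -/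
def divEnd (b : E m → N) : N := ∑ i, D i (b (e i))

/-- The bosonic operator on families of elements of a module. -/
def bosonicEnd (n : ℕ) (b : E m → N) (u : E m) : N :=
  (lapEnd D ^ n) (b u) - (4 * n / (m + 2 * n - 2) : ℝ) •
    combEnd D u (divEnd D fun w => (lapEnd D ^ (n - 1)) (b w))

/-- The fermionic operator on families of elements of a module. -/
def fermionicEnd (n : ℕ) (b : E m → N) (u : E m) : N :=
  diracEnd D L ((lapEnd D ^ (n - 1)) (b u))
    - (2 / (m + 2 * n - 2) : ℝ) •
        combEnd L u (divEnd D fun w => (lapEnd D ^ (n - 1)) (b w))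
    - ((4 * n - 4) / (m + 2 * n - 2) : ℝ) •
        combEnd D u (divEnd D fun w => (lapEnd D ^ (n - 2)) (diracEnd D L (b w)))

/-- The operator `𝒟_{1,k}` on families of elements of a module. -/
def higherSpinEnd (k : ℕ) (b : E m → N) (u : E m) : N :=
  if Even k then bosonicEnd D (k / 2) b u else fermionicEnd D L ((k + 1) / 2) b u

variable {D L D' L'} {T : N →ₗ[ℝ] N'}

theorem map_lapEnd_pow (hD : ∀ i b, T (D i b) = D' i (T b)) (n : ℕ) (b : N) :
    T ((lapEnd D ^ n) b) = (lapEnd D' ^ n) (T b) := by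
  induction n generalizing b with
  | zero => simp
  | succ n ih =>
    rw [pow_succ, pow_succ, Module.End.mul_apply, Module.End.mul_apply, ih]
    simp [lapEnd, hD]

/-- The operator is a real polynomial expression in the `D i` and `L i`, so any linear map
intertwining these intertwines it. Both the inclusion of decaying functions and the periodization
are of this kind. -/
theorem map_higherSpinEnd (hD : ∀ i b, T (D i b) = D' i (T b))
    (hL : ∀ i b, T (L i b) = L' i (T b)) (k : ℕ) (b : E m → N) (u : E m) :
    T (higherSpinEnd D L k b u) = higherSpinEnd D' L' k (fun w => T (b w)) u := by
  have hcD : ∀ b, T (combEnd D u b) = combEnd D' u (T b) := by simp [combEnd, hD]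
  have hcL : ∀ b, T (combEnd L u b) = combEnd L' u (T b) := by simp [combEnd, hL]
  have hd : ∀ b, T (divEnd D b) = divEnd D' fun w => T (b w) := by simp [divEnd, hD]
  have hdir : ∀ b, T (diracEnd D L b) = diracEnd D' L' (T b) := by simp [diracEnd, hD, hL]
  unfold higherSpinEnd bosonicEnd fermionicEnd
  split_ifs <;> simp only [map_sub, map_smul, hcD, hcL, hd, hdir, map_lapEnd_pow hD]

end Abstract

/-! ### Naturality of the operators -/

section Naturality

variable {m : ℕ} {X Y : Type} {P : Fin m → (X → Cl m) → X → Cl m}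
  {Q : Fin m → (Y → Cl m) → Y → Cl m} {φ : X → Y}

/-- The pull-back of functions of `(y, u)` along a map `φ : X → Y`. -/
def pull (φ : X → Y) (F : Y → E m → Cl m) : X → E m → Cl m := fun x u => F (φ x) u

theorem laplaceX_iterate_pull (h : ∀ i g x, P i (fun z => g (φ z)) x = Q i g (φ x)) (n : ℕ)
    (F : Y → E m → Cl m) :
    (laplaceX P)^[n] (pull φ F) = pull φ ((laplaceX Q)^[n] F) := by
  induction n generalizing F with
  | zero => rfl
  | succ n ih =>
    rw [Function.iterate_succ_apply, Function.iterate_succ_apply, ← ih]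
    congr 1
    funext x u
    refine Finset.sum_congr rfl fun i _ => ?_
    have : ∀ u, (fun z => dX P i (pull φ F) z u) = fun z => dX Q i F (φ z) u := fun u => by
      funext z; exact h i (fun y => F y u) z
    simp only [dX] at this ⊢
    rw [this, h i (fun y => Q i (fun z => F z u) y) x]

theorem higherSpin_pull (h : ∀ i g x, P i (fun z => g (φ z)) x = Q i g (φ x)) (k : ℕ)
    (F : Y → E m → Cl m) :
    higherSpin P k (pull φ F) = pull φ (higherSpin Q k F) := by
  have hX : ∀ i F, dX P i (pull φ F) = pull φ (dX Q i F) := fun i F => by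
    funext x u; exact h i (fun y => F y u) x
  have hD : ∀ F, diracX P (pull φ F) = pull φ (diracX Q F) := fun F => by
    funext x u; simp only [diracX, hX]; rfl
  have hu : ∀ F, uDX P (pull φ F) = pull φ (uDX Q F) := fun F => by
    funext x u; simp only [uDX, hX]; rfl
  have huD : ∀ F, dUdX P (pull φ F) = pull φ (dUdX Q F) := fun F => by
    funext x u; simp only [dUdX, hX]; rfl
  funext x u
  unfold higherSpin bosonic fermionic
  split_ifs <;> simp only [laplaceX_iterate_pull h, hD, hu, huD] <;> simp only [pull, *]

end Naturality

theorem opCyl_proj (m k l : ℕ) (F : Cyl m l → E m → Cl m) (x u : E m) :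
    opCyl m k l F (proj m l x) u = opE m k (fun z w => F (proj m l z) w) x u :=
  (congrFun (congrFun (higherSpin_pull (P := partialE) (Q := partialCyl) (φ := proj m l)
    (fun _ _ _ => rfl) k F) x) u).symm

/-- The operator has coefficients independent of `x`, hence is translation invariant. -/
theorem opE_sub (m k : ℕ) (F : E m → E m → Cl m) (x y u : E m) :
    opE m k (fun z w => F (z - y) w) x u = opE m k F (x - y) u := by
  refine congrFun (congrFun (higherSpin_pull (P := partialE) (Q := partialE)
    (φ := fun z => z - y) (fun i g z => ?_) k F) x) u
  simp only [partialE, lineDeriv, add_sub_right_comm]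

/-! ### Smooth functions on an open set -/

/-- The `Cl_m`-valued functions that are smooth on `Ω` and vanish off `Ω`. -/
def SmoothFn {m : ℕ} (Ω : TopologicalSpace.Opens (E m)) : Submodule ℝ (E m → Cl m) where
  carrier := {g | ContDiffOn ℝ ∞ g Ω ∧ ∀ x ∉ Ω, g x = 0}
  add_mem' ha hb := ⟨ha.1.add hb.1, fun x hx => by simp [ha.2 x hx, hb.2 x hx]⟩
  zero_mem' := ⟨contDiffOn_const, fun _ _ => rfl⟩
  smul_mem' c _ ha := ⟨contDiffOn_const.smul ha.1, fun _ hx => by simp [ha.2 _ hx]⟩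

namespace SmoothFn

variable {m : ℕ} {Ω : TopologicalSpace.Opens (E m)}

/-- The normalization by zero off `Ω` makes equality on `Ω` genuine equality, so that operator
identities become identities in a module. -/
theorem ext_on {f g : SmoothFn Ω} (h : ∀ x ∈ Ω, f.1 x = g.1 x) : f = g := by
  ext1; funext x
  by_cases hx : x ∈ Ω
  · exact h x hx
  · rw [f.2.2 x hx, g.2.2 x hx]

open Classical in
/-- The restriction to `Ω`, extended by zero, of a function that is smooth on `Ω`. -/
def trunc (g : E m → Cl m) (hg : ContDiffOn ℝ ∞ g Ω) : SmoothFn Ω :=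
  ⟨fun x => if x ∈ Ω then g x else 0, hg.congr fun _ hx => if_pos hx, fun _ hx => if_neg hx⟩

theorem trunc_apply {g : E m → Cl m} (hg : ContDiffOn ℝ ∞ g Ω) {x : E m} (hx : x ∈ Ω) :
    (trunc g hg).1 x = g x := if_pos hx

theorem contDiffAt (f : SmoothFn Ω) {x : E m} (hx : x ∈ Ω) : ContDiffAt ℝ ∞ f.1 x :=
  f.2.1.contDiffAt (Ω.isOpen.mem_nhds hx)

theorem differentiableAt (f : SmoothFn Ω) {x : E m} (hx : x ∈ Ω) : DifferentiableAt ℝ f.1 x :=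
  (contDiffAt f hx).differentiableAt (by simp)

theorem partialE_eq (f : SmoothFn Ω) {x : E m} (hx : x ∈ Ω) (i : Fin m) :
    partialE i f.1 x = fderiv ℝ f.1 x (e i) :=
  (differentiableAt f hx).lineDeriv_eq_fderiv

theorem contDiffOn_partialE (f : SmoothFn Ω) (i : Fin m) : ContDiffOn ℝ ∞ (partialE i f.1) Ω :=
  (((contDiffOn_infty_iff_fderiv_of_isOpen Ω.isOpen).1 f.2.1).2.clm_apply contDiffOn_const).congr
    fun _ hx => partialE_eq f hx i

/-- The partial derivative on smooth functions. -/
def pd (i : Fin m) : Module.End ℝ (SmoothFn Ω) where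
  toFun f := trunc (partialE i f.1) (contDiffOn_partialE f i)
  map_add' f g := ext_on fun x hx => by
    have hf := differentiableAt f hx
    have hg := differentiableAt g hx
    simp only [trunc_apply _ hx, Submodule.coe_add, Pi.add_apply, partialE_eq f hx,
      partialE_eq g hx]
    exact ((hf.hasFDerivAt.add hg.hasFDerivAt).hasLineDerivAt (e i)).lineDeriv
  map_smul' c f := ext_on fun x hx => by
    have hf := differentiableAt f hx
    simp only [trunc_apply _ hx, Submodule.coe_smul, Pi.smul_apply, partialE_eq f hx,
      RingHom.id_apply]
    exact ((hf.hasFDerivAt.const_smul c).hasLineDerivAt (e i)).lineDeriv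

theorem pd_apply (i : Fin m) (f : SmoothFn Ω) {x : E m} (hx : x ∈ Ω) :
    (pd i f).1 x = partialE i f.1 x := trunc_apply (contDiffOn_partialE f i) hx

theorem partialE_congr {f : E m → Cl m} {b : SmoothFn Ω} (h : ∀ x ∈ Ω, f x = b.1 x) (i : Fin m)
    {x : E m} (hx : x ∈ Ω) : partialE i f x = (pd i b).1 x := by
  rw [pd_apply i b hx]
  exact Filter.EventuallyEq.lineDeriv_eq (Filter.eventuallyEq_of_mem (Ω.isOpen.mem_nhds hx) h)

theorem pd_comm (i j : Fin m) (f : SmoothFn Ω) : pd i (pd j f) = pd j (pd i f) := by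
  refine ext_on fun x hx => ?_
  have key : ∀ i j : Fin m, (pd i (pd j f)).1 x = fderiv ℝ (fderiv ℝ f.1) x (e i) (e j) := by
    intro i j
    have hd : DifferentiableAt ℝ (fderiv ℝ f.1) x :=
      (((contDiffOn_infty_iff_fderiv_of_isOpen Ω.isOpen).1 f.2.1).2.contDiffAt
        (Ω.isOpen.mem_nhds hx)).differentiableAt (by simp)
    rw [← partialE_congr (f := fun z => fderiv ℝ f.1 z (e j))
      (fun z hz => by rw [pd_apply j f hz, partialE_eq f hz]) i hx]
    have := (hd.hasFDerivAt.clm_apply (hasFDerivAt_const (e j) x)).hasLineDerivAt (e i)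
    rw [partialE, this.lineDeriv]
    simp
  rw [key, key]
  exact (contDiffAt f hx).isSymmSndFDerivAt (by simpa using ENat.LEInfty.out) _ _

theorem contDiffOn_mul_left (a : Cl m) {g : E m → Cl m} {s : Set (E m)} (hg : ContDiffOn ℝ ∞ g s) :
    ContDiffOn ℝ ∞ (fun x => a * g x) s :=
  (LinearMap.toContinuousLinearMap (LinearMap.mulLeft ℝ a)).contDiff.comp_contDiffOn hg

/-- Left multiplication by a constant. -/
def lmul (a : Cl m) : Module.End ℝ (SmoothFn Ω) where
  toFun f := ⟨fun x => a * f.1 x, contDiffOn_mul_left a f.2.1, fun x hx => by simp [f.2.2 x hx]⟩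
  map_add' f g := by ext1; funext x; exact mul_add _ _ _
  map_smul' c f := by ext1; funext x; exact mul_smul_comm c a (f.1 x)

@[simp]
theorem lmul_apply (a : Cl m) (f : SmoothFn Ω) (x : E m) : (lmul a f).1 x = a * f.1 x := rfl

theorem pd_lmul (i : Fin m) (a : Cl m) (f : SmoothFn Ω) : pd i (lmul a f) = lmul a (pd i f) := by
  refine ext_on fun x hx => ?_
  rw [lmul_apply, pd_apply i _ hx, pd_apply i _ hx, partialE_eq f hx]
  exact (((LinearMap.toContinuousLinearMap (LinearMap.mulLeft ℝ a)).hasFDerivAt.comp x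
    (differentiableAt f hx).hasFDerivAt).hasLineDerivAt (e i)).lineDeriv

/-- Left multiplication by the basis vector `e_i`. -/
abbrev lm (i : Fin m) : Module.End ℝ (SmoothFn Ω) := lmul (vec (e i))

theorem coe_sum {ι : Type*} (s : Finset ι) (f : ι → SmoothFn Ω) (x : E m) :
    (∑ i ∈ s, f i).1 x = ∑ i ∈ s, (f i).1 x := by
  rw [AddSubmonoidClass.coe_finsetSum, Finset.sum_apply]

/-! ### Passing from operators on functions of `(x, u)` to the abstract operators. -/

/-- `F(x, u)` agrees on `Ω` with the family `b u` of smooth functions. -/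
def Represents (F : E m → E m → Cl m) (b : E m → SmoothFn Ω) : Prop :=
  ∀ x ∈ Ω, ∀ u, F x u = (b u).1 x

namespace Represents

variable {F : E m → E m → Cl m} {b : E m → SmoothFn Ω}

theorem dX (h : Represents F b) (i : Fin m) :
    Represents (dX partialE i F) fun u => pd i (b u) :=
  fun _ hx u => partialE_congr (fun z hz => h z hz u) i hx

theorem laplaceX (h : Represents F b) :
    Represents (laplaceX partialE F) fun u => lapEnd pd (b u) := fun x hx u => by
  simp only [Cylinder.laplaceX, lapEnd, LinearMap.sum_apply, coe_sum]
  exact Finset.sum_congr rfl fun i _ => (h.dX i).dX i x hx u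

theorem laplaceX_iterate (h : Represents F b) (n : ℕ) :
    Represents ((Cylinder.laplaceX partialE)^[n] F) fun u => (lapEnd pd ^ n) (b u) := by
  induction n generalizing F b with
  | zero => exact h
  | succ n ih => exact ih h.laplaceX

theorem diracX (h : Represents F b) :
    Represents (diracX partialE F) fun u => diracEnd pd lm (b u) := fun x hx u => by
  simp only [Cylinder.diracX, diracEnd, LinearMap.sum_apply, coe_sum]
  exact Finset.sum_congr rfl fun i _ => congrArg _ (h.dX i x hx u)

theorem uDX (h : Represents F b) :
    Represents (uDX partialE F) fun u => combEnd pd u (b u) := fun x hx u => by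
  simp only [Cylinder.uDX, combEnd, LinearMap.sum_apply, coe_sum]
  exact Finset.sum_congr rfl fun i _ => congrArg _ (h.dX i x hx u)

end Represents

theorem partialE_linear (T : E m →ₗ[ℝ] Cl m) (i : Fin m) (u : E m) : partialE i T u = T (e i) :=
  ((LinearMap.toContinuousLinearMap T).hasFDerivAt.hasLineDerivAt (e i)).lineDeriv

/-- Evaluation at a point. -/
def evalAt (x : E m) : SmoothFn Ω →ₗ[ℝ] Cl m where
  toFun f := f.1 x
  map_add' _ _ := rfl
  map_smul' _ _ := rfl

/-- Linearity in `u` is essential here: `∂_{u_i}` of a linear map is its value at `e_i`, so `⟨D_u,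
D_x⟩` becomes a divergence that no longer depends on `u`. -/
theorem Represents.dUdX {F : E m → E m → Cl m} {b : E m →ₗ[ℝ] SmoothFn Ω}
    (h : Represents F b) : Represents (dUdX partialE F) fun _ => divEnd pd b := fun x hx u => by
  simp only [Cylinder.dUdX, divEnd, coe_sum]
  refine Finset.sum_congr rfl fun i _ => ?_
  rw [Cylinder.dU, funext fun w => h.dX i x hx w]
  exact partialE_linear (evalAt x ∘ₗ pd i ∘ₗ b) i u

theorem sum_smul_vec (u : E m) : ∑ i, u i • vec (e i) = vec u := by
  have : u = ∑ i, u i • e i := by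
    simpa [e] using ((EuclideanSpace.basisFun (Fin m) ℝ).sum_repr u).symm
  conv_rhs => rw [this]
  simp [vec]

theorem combEnd_lm (u : E m) (f : SmoothFn Ω) : combEnd lm u f = lmul (vec u) f := by
  refine ext_on fun x _ => ?_
  rw [lmul_apply, ← sum_smul_vec, Finset.sum_mul, combEnd, LinearMap.sum_apply, coe_sum]
  exact Finset.sum_congr rfl fun i _ => (smul_mul_assoc (u i) (vec (e i)) (f.1 x)).symm

/-- On functions of `(x, u)` that are linear in `u`, the operator is the abstract one. -/
theorem Represents.opE {F : E m → E m → Cl m} {b : E m →ₗ[ℝ] SmoothFn Ω}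
    (h : Represents F b) (k : ℕ) : Represents (opE m k F) fun u => higherSpinEnd pd lm k b u := by
  intro x hx u
  have hdiv : ∀ n, Represents (Cylinder.dUdX partialE ((Cylinder.laplaceX partialE)^[n] F))
      fun _ => divEnd pd fun w => (lapEnd pd ^ n) (b w) := fun n =>
    Represents.dUdX (b := (lapEnd pd ^ n) ∘ₗ b) (h.laplaceX_iterate n)
  have hdiv' : ∀ n, Represents (Cylinder.dUdX partialE ((Cylinder.laplaceX partialE)^[n]
      (Cylinder.diracX partialE F)))
      fun _ => divEnd pd fun w => (lapEnd pd ^ n) (diracEnd pd lm (b w)) := fun n =>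
    Represents.dUdX (b := (lapEnd pd ^ n) ∘ₗ diracEnd pd lm ∘ₗ b) (h.diracX.laplaceX_iterate n)
  unfold Cylinder.opE higherSpin higherSpinEnd
  split_ifs
  · rw [bosonic, h.laplaceX_iterate _ x hx u, (hdiv _).uDX x hx u]
    rfl
  · rw [fermionic, (h.laplaceX_iterate _).diracX x hx u, hdiv _ x hx u, (hdiv' _).uDX x hx u,
      ← lmul_apply, ← combEnd_lm]
    rfl

end SmoothFn

/-! ### Calculus on the punctured space -/

/-- The open set `ℝ^m \ {0}`. -/
def punctured (m : ℕ) : TopologicalSpace.Opens (E m) := ⟨{0}ᶜ, isOpen_compl_singleton⟩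

theorem mem_punctured {m : ℕ} {x : E m} : x ∈ punctured m ↔ x ≠ 0 := Iff.rfl

theorem sum_smul_e {m : ℕ} (u : E m) : ∑ i, u i • e i = u := by
  simpa [e] using (EuclideanSpace.basisFun (Fin m) ℝ).sum_repr u

theorem sum_smul_map_e {m : ℕ} (w : E m →ₗ[ℝ] Cl m) (u : E m) : ∑ i, u i • w (e i) = w u := by
  conv_rhs => rw [← sum_smul_e u]
  simp

theorem inner_e {m : ℕ} (x : E m) (i : Fin m) : ⟪x, e i⟫_ℝ = x i := by
  simp [e, EuclideanSpace.inner_single_right]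

theorem sum_sq_eq {m : ℕ} (x : E m) : ∑ i, x i * x i = ‖x‖ ^ 2 := by
  rw [EuclideanSpace.norm_sq_eq]
  exact Finset.sum_congr rfl fun i _ => by rw [Real.norm_eq_abs, sq_abs, sq]

theorem vec_mul_vec_add_swap {m : ℕ} (x y : E m) :
    vec x * vec y = -(vec y * vec x) - (2 * ⟪x, y⟫_ℝ) • (1 : Cl m) := by
  have h := CliffordAlgebra.ι_mul_ι_add_swap (Q := negSq m) x y
  have hp : QuadraticMap.polar (negSq m) x y = -(2 * ⟪x, y⟫_ℝ) := by
    simp only [QuadraticMap.polar, negSq_apply, norm_add_sq_real]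
    ring
  rw [hp, Algebra.algebraMap_eq_smul_one] at h
  rw [eq_sub_iff_add_eq, ← sub_eq_zero, ← sub_eq_zero.2 h]
  module

theorem contDiffOn_norm_zpow {m : ℕ} (p : ℤ) :
    ContDiffOn ℝ ∞ (fun x : E m => ‖x‖ ^ p) (punctured m) := by
  intro x hx
  have hx : x ≠ 0 := hx
  refine ContDiffAt.contDiffWithinAt ?_
  have hn : ContDiffAt ℝ ∞ (fun x : E m => ‖x‖) x := contDiffAt_norm ℝ hx
  obtain ⟨n, rfl | rfl⟩ := p.eq_nat_or_neg
  · simpa using hn.pow n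
  · simp only [zpow_neg, zpow_natCast]
    exact (hn.pow n).inv (pow_ne_zero n (norm_ne_zero_iff.2 hx))

theorem hasFDerivAt_norm_zpow {m : ℕ} (p : ℤ) {x : E m} (hx : x ≠ 0) :
    HasFDerivAt (fun x : E m => ‖x‖ ^ p) (((p : ℝ) * ‖x‖ ^ (p - 2)) • innerSL ℝ x) x := by
  have hn : ‖x‖ ≠ 0 := norm_ne_zero_iff.2 hx
  -- The norm is differentiated as the square root of the smooth function `‖x‖²`.
  have h1 := (hasStrictFDerivAt_norm_sq x).hasFDerivAt.sqrt (pow_ne_zero 2 hn)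
  simp only [Real.sqrt_sq (norm_nonneg _)] at h1
  refine ((hasDerivAt_zpow p ‖x‖ (Or.inl hn)).comp_hasFDerivAt x h1).congr_fderiv ?_
  ext v
  have : ‖x‖ ^ (p - 1) = ‖x‖ ^ (p - 2) * ‖x‖ := by
    rw [← zpow_add_one₀ hn]; congr 1; ring
  simp [this]
  field_simp

namespace SmoothFn

variable {m : ℕ} {Ω : TopologicalSpace.Opens (E m)}

/-- Multiplication by a smooth scalar function. -/
def smulFn (φ : E m → ℝ) (hφ : ContDiffOn ℝ ∞ φ Ω) : Module.End ℝ (SmoothFn Ω) where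
  toFun f := ⟨fun x => φ x • f.1 x, hφ.smul f.2.1, fun x hx => by simp [f.2.2 x hx]⟩
  map_add' f g := by ext1; funext x; exact smul_add (φ x) (f.1 x) (g.1 x)
  map_smul' c f := by ext1; funext x; exact smul_comm (φ x) c (f.1 x)

theorem pd_smulFn (φ : E m → ℝ) (hφ : ContDiffOn ℝ ∞ φ Ω) (f : SmoothFn Ω) {x : E m} (hx : x ∈ Ω)
    {φ' : E m →L[ℝ] ℝ} (h' : HasFDerivAt φ φ' x) (i : Fin m) :
    (pd i (smulFn φ hφ f)).1 x = φ' (e i) • f.1 x + φ x • (pd i f).1 x := by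
  rw [pd_apply i _ hx, pd_apply i _ hx, partialE_eq f hx, add_comm]
  exact ((h'.smul (differentiableAt f hx).hasFDerivAt).hasLineDerivAt (e i)).lineDeriv

/-- Multiplication by `⟨x, u⟩`. -/
def imul (u : E m) : Module.End ℝ (SmoothFn Ω) :=
  smulFn (fun x => ⟪x, u⟫_ℝ) (contDiff_id.inner ℝ contDiff_const).contDiffOn

@[simp]
theorem imul_apply (u : E m) (f : SmoothFn Ω) (x : E m) : (imul u f).1 x = ⟪x, u⟫_ℝ • f.1 x := rfl

theorem pd_imul (u : E m) (f : SmoothFn Ω) (i : Fin m) :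
    pd i (imul u f) = u i • f + imul u (pd i f) := by
  refine ext_on fun x hx => ?_
  have h : HasFDerivAt (fun x : E m => ⟪x, u⟫_ℝ) (innerSL ℝ u) x := by
    simpa [real_inner_comm] using (innerSL ℝ u).hasFDerivAt (x := x)
  rw [imul, pd_smulFn _ _ f hx h, innerSL_apply_apply, inner_e]
  rfl

/-- Left multiplication by the vector variable `x`. -/
def vmul : Module.End ℝ (SmoothFn Ω) := ∑ i, lm i * imul (e i)

theorem vmul_eq_sum (f : SmoothFn Ω) : vmul f = ∑ i, lm i (imul (e i) f) := by
  simp only [vmul, LinearMap.sum_apply, Module.End.mul_apply]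

theorem vmul_apply (f : SmoothFn Ω) (x : E m) : (vmul f).1 x = vec x * f.1 x := by
  rw [← sum_smul_vec x, Finset.sum_mul, vmul, LinearMap.sum_apply, coe_sum]
  refine Finset.sum_congr rfl fun i _ => ?_
  rw [Module.End.mul_apply, lmul_apply, imul_apply, inner_e, mul_smul_comm, smul_mul_assoc]

theorem e_apply (i j : Fin m) : e i j = if j = i then (1 : ℝ) else 0 := by
  simp [e]

theorem pd_vmul (f : SmoothFn Ω) (i : Fin m) : pd i (vmul f) = lm i f + vmul (pd i f) := by
  simp only [vmul, LinearMap.sum_apply, map_sum, Module.End.mul_apply, pd_lmul, pd_imul, map_add,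
    Finset.sum_add_distrib, map_smul, e_apply]
  simp

/-- Constant functions. -/
def const (c : Cl m) : SmoothFn Ω := trunc (fun _ => c) contDiffOn_const

theorem const_apply (c : Cl m) {x : E m} (hx : x ∈ Ω) : (const (Ω := Ω) c).1 x = c :=
  trunc_apply _ hx

theorem pd_const (c : Cl m) (i : Fin m) : pd i (const (Ω := Ω) c) = 0 := by
  refine ext_on fun x hx => ?_
  rw [← partialE_congr (f := fun _ => c) (fun z hz => (const_apply c hz).symm) i hx]
  exact ((hasFDerivAt_const c x).hasLineDerivAt (e i)).lineDeriv

/-- Linear functions. -/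
def lin (w : E m →ₗ[ℝ] Cl m) : SmoothFn Ω :=
  trunc w (LinearMap.toContinuousLinearMap w).contDiff.contDiffOn

theorem lin_apply (w : E m →ₗ[ℝ] Cl m) {x : E m} (hx : x ∈ Ω) : (lin (Ω := Ω) w).1 x = w x :=
  trunc_apply _ hx

theorem pd_lin (w : E m →ₗ[ℝ] Cl m) (i : Fin m) : pd i (lin (Ω := Ω) w) = const (w (e i)) := by
  refine ext_on fun x hx => ?_
  rw [← partialE_congr (f := w) (fun z hz => (lin_apply w hz).symm) i hx, const_apply _ hx,
    partialE_linear]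

theorem sum_imul_const (w : E m →ₗ[ℝ] Cl m) :
    ∑ i, imul (e i) (const (Ω := Ω) (w (e i))) = lin w := by
  refine ext_on fun x hx => ?_
  simp only [coe_sum, imul_apply, inner_e, const_apply _ hx, lin_apply _ hx, sum_smul_map_e]

theorem sum_smul_const (w : E m →ₗ[ℝ] Cl m) (u : E m) :
    ∑ i, u i • const (Ω := Ω) (w (e i)) = const (w u) := by
  refine ext_on fun x hx => ?_
  simp only [coe_sum, Submodule.coe_smul, Pi.smul_apply, const_apply _ hx, sum_smul_map_e]

theorem lmul_const (a c : Cl m) : lmul a (const (Ω := Ω) c) = const (a * c) := by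
  refine ext_on fun x hx => ?_
  simp only [lmul_apply, const_apply _ hx]

theorem sum_const {ι : Type*} (s : Finset ι) (c : ι → Cl m) :
    ∑ i ∈ s, const (Ω := Ω) (c i) = const (∑ i ∈ s, c i) := by
  refine ext_on fun x hx => ?_
  simp only [coe_sum, const_apply _ hx]

theorem lmul_imul (a : Cl m) (u : E m) (f : SmoothFn Ω) : lmul a (imul u f) = imul u (lmul a f) :=
  ext_on fun _ _ => by simp

theorem imul_comm (u v : E m) (f : SmoothFn Ω) : imul u (imul v f) = imul v (imul u f) :=
  ext_on fun x _ => smul_comm ⟪x, u⟫_ℝ ⟪x, v⟫_ℝ (f.1 x)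

theorem lm_lm (i : Fin m) (f : SmoothFn Ω) : lm i (lm i f) = -f := by
  refine ext_on fun x _ => ?_
  change vec (e i) * (vec (e i) * f.1 x) = -f.1 x
  rw [← mul_assoc, vec_mul_self]
  simp [e]

theorem lmul_vmul (u : E m) (f : SmoothFn Ω) :
    lmul (vec u) (vmul f) = -vmul (lmul (vec u) f) - (2 : ℝ) • imul u f := by
  refine ext_on fun x _ => ?_
  change vec u * (vmul f).1 x = -(vmul (lmul (vec u) f)).1 x - (2 : ℝ) • (imul u f).1 x
  rw [vmul_apply, vmul_apply, lmul_apply, imul_apply, ← mul_assoc, vec_mul_vec_add_swap, sub_mul,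
    real_inner_comm, smul_mul_assoc, one_mul, smul_smul, neg_mul, mul_assoc]

theorem lm_vmul (i : Fin m) (f : SmoothFn Ω) :
    lm i (vmul f) = -vmul (lm i f) - (2 : ℝ) • imul (e i) f :=
  lmul_vmul (e i) f

/-- The Euler operator `∑ x_i ∂_i`. -/
def euler : Module.End ℝ (SmoothFn Ω) := ∑ i, imul (e i) * pd i

theorem euler_apply (f : SmoothFn Ω) : euler f = ∑ i, imul (e i) (pd i f) := by
  simp [euler]

theorem sum_apply_smul_imul (u : E m) (f : SmoothFn Ω) : ∑ i, u i • imul (e i) f = imul u f := by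
  refine ext_on fun x _ => ?_
  simp only [coe_sum, Submodule.coe_smul, Pi.smul_apply, imul_apply, smul_smul, ← Finset.sum_smul,
    inner_e]
  simp [PiLp.inner_apply]

theorem euler_const (c : Cl m) : euler (const (Ω := Ω) c) = 0 := by
  simp [euler_apply, pd_const]

theorem euler_lin (w : E m →ₗ[ℝ] Cl m) : euler (lin (Ω := Ω) w) = lin w := by
  simp [euler_apply, pd_lin, sum_imul_const]

theorem euler_imul (u : E m) (f : SmoothFn Ω) : euler (imul u f) = imul u f + imul u (euler f) := by
  simp only [euler_apply, pd_imul, map_add, map_smul, Finset.sum_add_distrib, sum_apply_smul_imul,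
    map_sum, imul_comm]

theorem lapEnd_apply (f : SmoothFn Ω) : lapEnd pd f = ∑ i, pd i (pd i f) := by
  simp [lapEnd]

theorem diracEnd_apply (f : SmoothFn Ω) : diracEnd pd lm f = ∑ i, lm i (pd i f) := by
  simp [diracEnd]

theorem combEnd_pd_apply (u : E m) (f : SmoothFn Ω) : combEnd pd u f = ∑ i, u i • pd i f := by
  simp [combEnd]

theorem lapEnd_const (c : Cl m) : lapEnd pd (const (Ω := Ω) c) = 0 := by
  simp [lapEnd_apply, pd_const]

theorem lapEnd_lin (w : E m →ₗ[ℝ] Cl m) : lapEnd pd (lin (Ω := Ω) w) = 0 := by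
  simp [lapEnd_apply, pd_lin, pd_const]

theorem lapEnd_imul (u : E m) (f : SmoothFn Ω) :
    lapEnd pd (imul u f) = (2 : ℝ) • combEnd pd u f + imul u (lapEnd pd f) := by
  simp only [lapEnd_apply, pd_imul, map_add, map_smul, Finset.sum_add_distrib, map_sum,
    combEnd_pd_apply]
  module

theorem combEnd_lin (w : E m →ₗ[ℝ] Cl m) (u : E m) :
    combEnd pd u (lin (Ω := Ω) w) = const (w u) := by
  rw [combEnd_pd_apply]
  simp only [pd_lin, sum_smul_const]

theorem diracEnd_const (c : Cl m) : diracEnd pd lm (const (Ω := Ω) c) = 0 := by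
  simp [diracEnd_apply, pd_const]

theorem diracEnd_lin {w : E m →ₗ[ℝ] Cl m} (hw : ∑ i, vec (e i) * w (e i) = 0) :
    diracEnd pd lm (lin (Ω := Ω) w) = 0 := by
  simp only [diracEnd_apply, pd_lin, lmul_const, sum_const, hw]
  exact ext_on fun x hx => const_apply 0 hx

theorem diracEnd_imul (u : E m) (f : SmoothFn Ω) :
    diracEnd pd lm (imul u f) = lmul (vec u) f + imul u (diracEnd pd lm f) := by
  simp only [diracEnd_apply, pd_imul, map_add, map_smul, Finset.sum_add_distrib, map_sum,
    lmul_imul]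
  rw [← combEnd_lm]
  simp [combEnd]

theorem pd_lapEnd_pow (i : Fin m) (n : ℕ) (f : SmoothFn Ω) :
    pd i ((lapEnd pd ^ n) f) = (lapEnd pd ^ n) (pd i f) :=
  map_lapEnd_pow (T := pd i) (fun _ _ => pd_comm _ _ _) n f

theorem lmul_lapEnd_pow (a : Cl m) (n : ℕ) (f : SmoothFn Ω) :
    lmul a ((lapEnd pd ^ n) f) = (lapEnd pd ^ n) (lmul a f) :=
  map_lapEnd_pow (T := lmul a) (fun i f => (pd_lmul i a f).symm) n f

theorem diracEnd_pd (i : Fin m) (f : SmoothFn Ω) :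
    diracEnd pd lm (pd i f) = pd i (diracEnd pd lm f) := by
  simp only [diracEnd_apply, map_sum, pd_lmul, pd_comm _ i]

theorem diracEnd_lapEnd_pow (n : ℕ) (f : SmoothFn Ω) :
    diracEnd pd lm ((lapEnd pd ^ n) f) = (lapEnd pd ^ n) (diracEnd pd lm f) :=
  map_lapEnd_pow (T := diracEnd pd lm) (fun i f => diracEnd_pd i f) n f

theorem combEnd_lapEnd_pow (u : E m) (n : ℕ) (f : SmoothFn Ω) :
    combEnd pd u ((lapEnd pd ^ n) f) = (lapEnd pd ^ n) (combEnd pd u f) := by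
  simp only [combEnd_pd_apply, pd_lapEnd_pow, map_sum, map_smul]

theorem divEnd_lapEnd_pow (n : ℕ) (b : E m → SmoothFn Ω) :
    (divEnd pd fun w => (lapEnd pd ^ n) (b w)) = (lapEnd pd ^ n) (divEnd pd b) := by
  simp only [divEnd, pd_lapEnd_pow, map_sum]

theorem divEnd_diracEnd (b : E m → SmoothFn Ω) :
    (divEnd pd fun w => diracEnd pd lm (b w)) = diracEnd pd lm (divEnd pd b) := by
  simp only [divEnd, diracEnd_pd, map_sum]

/-! ### Product rules for powers of the norm on the punctured space. -/

/-- Multiplication by `‖x‖^p`. -/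
def rmul (p : ℤ) : Module.End ℝ (SmoothFn (punctured m)) :=
  smulFn (fun x => ‖x‖ ^ p) (contDiffOn_norm_zpow p)

theorem rmul_apply (p : ℤ) (f : SmoothFn (punctured m)) (x : E m) :
    (rmul p f).1 x = ‖x‖ ^ p • f.1 x := rfl

theorem rmul_rmul (p q : ℤ) (f : SmoothFn (punctured m)) : rmul p (rmul q f) = rmul (p + q) f :=
  ext_on fun x hx => by
    rw [rmul_apply, rmul_apply, rmul_apply, smul_smul, zpow_add₀ (norm_ne_zero_iff.2 hx)]

theorem pd_rmul (p : ℤ) (f : SmoothFn (punctured m)) (i : Fin m) :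
    pd i (rmul p f) = (p : ℝ) • rmul (p - 2) (imul (e i) f) + rmul p (pd i f) := by
  refine ext_on fun x hx => ?_
  rw [rmul, pd_smulFn _ _ f hx (hasFDerivAt_norm_zpow p hx)]
  change _ = (p : ℝ) • (rmul (p - 2) (imul (e i) f)).1 x + ‖x‖ ^ p • (pd i f).1 x
  rw [rmul_apply, imul_apply, smul_smul, smul_smul]
  rfl

theorem sum_imul_imul (f : SmoothFn (punctured m)) : ∑ i, imul (e i) (imul (e i) f) = rmul 2 f := by
  refine ext_on fun x hx => ?_
  simp only [coe_sum, imul_apply, smul_smul, ← Finset.sum_smul, inner_e, rmul_apply, sum_sq_eq]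
  rfl

theorem vmul_vmul (f : SmoothFn (punctured m)) : vmul (vmul f) = -rmul 2 f := by
  refine ext_on fun x hx => ?_
  change _ = -(rmul 2 f).1 x
  rw [vmul_apply, vmul_apply, ← mul_assoc, vec_mul_self, rmul_apply, Algebra.algebraMap_eq_smul_one,
    smul_mul_assoc, one_mul, neg_smul]
  rfl

theorem imul_rmul (u : E m) (p : ℤ) (f : SmoothFn (punctured m)) :
    imul u (rmul p f) = rmul p (imul u f) :=
  ext_on fun x _ => smul_comm ⟪x, u⟫_ℝ (‖x‖ ^ p) (f.1 x)

theorem lmul_rmul (a : Cl m) (p : ℤ) (f : SmoothFn (punctured m)) :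
    lmul a (rmul p f) = rmul p (lmul a f) :=
  ext_on fun x _ => by simp only [lmul_apply, rmul_apply, mul_smul_comm]

theorem vmul_rmul (p : ℤ) (f : SmoothFn (punctured m)) :
    vmul (rmul p f) = rmul p (vmul f) :=
  ext_on fun x _ => by simp only [vmul_apply, rmul_apply, mul_smul_comm]

theorem combEnd_rmul (u : E m) (p : ℤ) (f : SmoothFn (punctured m)) :
    combEnd pd u (rmul p f) = (p : ℝ) • rmul (p - 2) (imul u f) + rmul p (combEnd pd u f) := by
  simp only [combEnd_pd_apply, pd_rmul, smul_add, Finset.sum_add_distrib, map_sum, map_smul]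
  rw [← sum_apply_smul_imul u f]
  simp only [map_sum, map_smul, Finset.smul_sum, smul_comm (p : ℝ)]

/-- The cross term of the product rule is radial, which is why only the Euler operator appears; on
homogeneous `f` everything reduces to a scalar. -/
theorem lapEnd_rmul (p : ℤ) (f : SmoothFn (punctured m)) :
    lapEnd pd (rmul p f) = (p * (p + m - 2) : ℝ) • rmul (p - 2) f
      + (2 * p : ℝ) • rmul (p - 2) (euler f) + rmul p (lapEnd pd f) := by
  have h1 : ∀ i, pd i (pd i (rmul p f)) =
      (p * (p - 2) : ℝ) • rmul (p - 4) (imul (e i) (imul (e i) f)) + (p : ℝ) • rmul (p - 2) f +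
      (2 * p : ℝ) • rmul (p - 2) (imul (e i) (pd i f)) + rmul p (pd i (pd i f)) := by
    intro i
    have h4 : p - 2 - 2 = p - 4 := by ring
    have hi : e i i = (1 : ℝ) := by simp [e_apply]
    simp only [pd_rmul, map_add, map_smul, pd_imul, h4, hi]
    push_cast
    module
  have h2 : p - 4 + 2 = p - 2 := by ring
  rw [lapEnd_apply, Finset.sum_congr rfl fun i _ => h1 i]
  simp only [Finset.sum_add_distrib, ← Finset.smul_sum, ← map_sum, sum_imul_imul, rmul_rmul, h2,
    ← euler_apply, ← lapEnd_apply, Finset.sum_const, Finset.card_univ, Fintype.card_fin,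
    map_smul, ← Nat.cast_smul_eq_nsmul ℝ]
  module

/-- Moving `e_i` past `x` by `e_i x = -x e_i - 2x_i` produces the Euler term. The relations `e_i² =
-1` and `x² = -‖x‖²` contribute `-m` and `-p` to the scalar. -/
theorem diracEnd_rmul_vmul (p : ℤ) (f : SmoothFn (punctured m)) :
    diracEnd pd lm (rmul p (vmul f)) = (-(p + m) : ℝ) • rmul p f
      - rmul p (vmul (diracEnd pd lm f)) - (2 : ℝ) • rmul p (euler f) := by
  have h1 : ∀ i, lm i (pd i (rmul p (vmul f))) =
      (p : ℝ) • rmul (p - 2) (lm i (imul (e i) (vmul f))) - rmul p f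
      - rmul p (vmul (lm i (pd i f))) - (2 : ℝ) • rmul p (imul (e i) (pd i f)) := by
    intro i
    simp only [pd_rmul, pd_vmul, map_add, map_smul, lmul_rmul, lm_lm, lm_vmul, map_neg, map_sub]
    module
  have h3 : ∑ i, lm i (imul (e i) (vmul f)) = vmul (vmul f) := (vmul_eq_sum _).symm
  rw [diracEnd_apply, Finset.sum_congr rfl fun i _ => h1 i]
  simp only [Finset.sum_sub_distrib, ← Finset.smul_sum, ← map_sum, h3, vmul_vmul, map_neg,
    rmul_rmul, sub_add_cancel,
    ← euler_apply, ← diracEnd_apply, Finset.sum_const, Finset.card_univ, Fintype.card_fin,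
    map_smul, ← Nat.cast_smul_eq_nsmul ℝ]
  module

end SmoothFn

/-! ### The operators annihilate the kernels on the punctured space -/

open SmoothFn

section Kernels

variable {m : ℕ}

/-- The function `‖x‖^a w(xux/‖x‖²)` of `x`, linear in `u`. -/
def scalarKernel (a : ℤ) (w : E m →ₗ[ℝ] Cl m) : E m →ₗ[ℝ] SmoothFn (punctured m) where
  toFun u := rmul a (const (w u)) - (2 : ℝ) • rmul (a - 2) (imul u (lin w))
  map_add' u v := by
    have h1 : const (Ω := punctured m) (w (u + v)) = const (w u) + const (w v) :=
      ext_on fun x hx => by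
        simp only [Submodule.coe_add, Pi.add_apply, const_apply _ hx, map_add]
    have h2 : ∀ f : SmoothFn (punctured m), imul (u + v) f = imul u f + imul v f := fun f =>
      ext_on fun x hx => by
        simp only [Submodule.coe_add, Pi.add_apply, imul_apply, inner_add_right, add_smul]
    rw [h1, h2]
    simp only [map_add]
    module
  map_smul' c u := by
    have h1 : const (Ω := punctured m) (w (c • u)) = c • const (w u) :=
      ext_on fun x hx => by
        simp only [Submodule.coe_smul, Pi.smul_apply, const_apply _ hx, map_smul]
    have h2 : ∀ f : SmoothFn (punctured m), imul (c • u) f = c • imul u f := fun f =>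
      ext_on fun x hx => by
        simp only [Submodule.coe_smul, Pi.smul_apply, imul_apply, inner_smul_right, mul_smul]
    rw [h1, h2]
    simp only [map_smul, RingHom.id_apply]
    module

theorem scalarKernel_def (a : ℤ) (w : E m →ₗ[ℝ] Cl m) (u : E m) :
    scalarKernel a w u = rmul a (const (w u)) - (2 : ℝ) • rmul (a - 2) (imul u (lin w)) := rfl

/-- The function `x ‖x‖^a w(xux/‖x‖²)` of `x`, linear in `u`. -/
def spinorKernel (a : ℤ) (w : E m →ₗ[ℝ] Cl m) : E m →ₗ[ℝ] SmoothFn (punctured m) :=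
  vmul ∘ₗ scalarKernel a w

theorem divEnd_scalarKernel (a : ℤ) (w : E m →ₗ[ℝ] Cl m) :
    divEnd pd (scalarKernel a w) = (2 - 2 * m - a : ℝ) • rmul (a - 2) (lin w) := by
  have h1 : ∀ i, pd i (scalarKernel a w (e i)) =
      (a : ℝ) • rmul (a - 2) (imul (e i) (const (w (e i))))
      - (2 * (a - 2) : ℝ) • rmul (a - 4) (imul (e i) (imul (e i) (lin w)))
      - (2 : ℝ) • rmul (a - 2) (lin w)
      - (2 : ℝ) • rmul (a - 2) (imul (e i) (const (w (e i)))) := by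
    intro i
    have h4 : a - 2 - 2 = a - 4 := by ring
    have hi : e i i = (1 : ℝ) := by simp [e_apply]
    simp only [scalarKernel_def, map_sub, map_smul, pd_rmul, pd_const, pd_imul, pd_lin, map_add,
      map_zero, h4, hi]
    push_cast
    module
  have h2 : a - 4 + 2 = a - 2 := by ring
  rw [divEnd, Finset.sum_congr rfl fun i _ => h1 i]
  simp only [Finset.sum_sub_distrib, ← Finset.smul_sum, ← map_sum, sum_imul_imul, rmul_rmul, h2,
    sum_imul_const, Finset.sum_const, Finset.card_univ, Fintype.card_fin, map_smul,
    ← Nat.cast_smul_eq_nsmul ℝ]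
  module

/-- The exponent `a = 2n - m` is exactly the one for which the `⟨x,u⟩ w(x)` terms cancel: they enter
with coefficients `-2(a-2)(a+m)` and `4n(a-2)`. -/
theorem lapEnd_scalarKernel_add (n : ℕ) {a : ℤ} (ha : a = 2 * n - m) (w : E m →ₗ[ℝ] Cl m)
    (u : E m) :
    lapEnd pd (scalarKernel a w u) + (4 * n : ℝ) • combEnd pd u (rmul (a - 2) (lin w)) =
      ((2 * n - 2) * (2 * n - m + 2) : ℝ) • rmul (a - 2) (const (w u)) := by
  have h4 : a - 2 - 2 = a - 4 := by ring
  have ha' : (a : ℝ) = 2 * n - m := by rw [ha]; push_cast; ring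
  simp only [scalarKernel_def, map_sub, map_smul, lapEnd_rmul, lapEnd_const, lapEnd_imul,
    lapEnd_lin, euler_const, euler_imul, euler_lin, combEnd_lin, combEnd_rmul, map_add,
    map_zero, h4]
  push_cast
  rw [ha']
  module

/-- Each Laplacian sends `‖x‖^(2j-m)` to a multiple of `‖x‖^(2(j-1)-m)`; the chain ends at
`‖x‖^(2-m)`, where the factor `p + m - 2` vanishes. -/
theorem lapEnd_pow_rmul_const (n : ℕ) (c : Cl m) :
    (lapEnd pd ^ (n + 1)) (rmul (2 * (n + 1 : ℕ) - m) (const c)) = 0 := by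
  induction n with
  | zero =>
    rw [zero_add, pow_one, lapEnd_rmul, euler_const, lapEnd_const]
    simp
  | succ n ih =>
    have h : (2 * ((n + 1 + 1 : ℕ) : ℤ) - m - 2) = 2 * (n + 1 : ℕ) - m := by push_cast; ring
    rw [pow_succ, Module.End.mul_apply, lapEnd_rmul, euler_const, lapEnd_const, h]
    simp only [map_zero, smul_zero, add_zero, map_smul, ih]

theorem lapEnd_pow_lapEnd_scalarKernel_add (n : ℕ) {a : ℤ} (ha : a = 2 * (n + 1 : ℕ) - m)
    (w : E m →ₗ[ℝ] Cl m) (u : E m) :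
    (lapEnd pd ^ n) (lapEnd pd (scalarKernel a w u)
      + (4 * (n + 1 : ℕ) : ℝ) • combEnd pd u (rmul (a - 2) (lin w))) = 0 := by
  rw [lapEnd_scalarKernel_add (n + 1) ha, map_smul]
  cases n with
  -- The factor `2n - 2` of the bracket vanishes for the operator of order two.
  | zero => simp
  | succ n =>
    have h : a - 2 = 2 * (n + 1 : ℕ) - m := by rw [ha]; push_cast; ring
    rw [h, lapEnd_pow_rmul_const, smul_zero]

theorem bosonicEnd_scalarKernel (n : ℕ) (hm : 0 < m) {a : ℤ} (ha : a = 2 * (n + 1 : ℕ) - m)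
    (w : E m →ₗ[ℝ] Cl m) (u : E m) :
    bosonicEnd pd (n + 1) (scalarKernel a w) u = 0 := by
  rw [bosonicEnd, Nat.add_sub_cancel, divEnd_lapEnd_pow, combEnd_lapEnd_pow, pow_succ,
    Module.End.mul_apply, ← map_smul, ← map_sub, ← lapEnd_pow_lapEnd_scalarKernel_add n ha w u,
    divEnd_scalarKernel, map_smul, smul_smul, sub_eq_add_neg, ← neg_smul]
  -- Only a scalar identity remains: for this `a`, the divergence coefficient `2 - 2m - a` is minus
  -- the denominator of the operator.
  congr 3
  have hm' : (0 : ℝ) < m := by exact_mod_cast hm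
  have hd : (m + 2 * (n + 1 : ℕ) - 2 : ℝ) = m + 2 * n := by push_cast; ring
  have hne : (m + 2 * n : ℝ) ≠ 0 := by positivity
  rw [ha, hd]
  push_cast
  field_simp
  ring

theorem sum_lm_scalarKernel {w : E m →ₗ[ℝ] Cl m} (hw : ∑ i, vec (e i) * w (e i) = 0) (a : ℤ) :
    ∑ i, lm i (scalarKernel a w (e i)) = (-2 : ℝ) • rmul (a - 2) (vmul (lin w)) := by
  have h0 : const (Ω := punctured m) (0 : Cl m) = 0 := ext_on fun x hx => const_apply 0 hx
  simp only [scalarKernel_def, map_sub, map_smul, lmul_rmul, lmul_const, Finset.sum_sub_distrib,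
      ← Finset.smul_sum, ← map_sum, sum_const, hw, ← vmul_eq_sum, h0, map_zero]
  module

theorem divEnd_spinorKernel {w : E m →ₗ[ℝ] Cl m} (hw : ∑ i, vec (e i) * w (e i) = 0)
    (a : ℤ) :
    divEnd pd (spinorKernel a w) = (-(2 * m + a) : ℝ) • rmul (a - 2) (vmul (lin w)) := by
  have h1 : divEnd pd (spinorKernel a w) =
      ∑ i, lm i (scalarKernel a w (e i)) + vmul (divEnd pd (scalarKernel a w)) := by
    simp only [divEnd, spinorKernel, LinearMap.comp_apply, pd_vmul, Finset.sum_add_distrib, map_sum]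
  rw [h1, sum_lm_scalarKernel hw, divEnd_scalarKernel, map_smul, vmul_rmul]
  module

theorem sum_imul_scalarKernel (a : ℤ) (w : E m →ₗ[ℝ] Cl m) :
    ∑ i, imul (e i) (scalarKernel a w (e i)) = -rmul a (lin w) := by
  simp only [scalarKernel_def, map_sub, map_smul, imul_rmul, Finset.sum_sub_distrib,
    ← Finset.smul_sum, ← map_sum, sum_imul_const, sum_imul_imul, rmul_rmul, sub_add_cancel]
  module

/-- Anticommuting `e_i` past `x` leaves two multiples of `‖x‖^a w(x)`, with coefficients `-2` and
`2`. This gives monogenicity in `u` of the odd kernels. -/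
theorem sum_lm_spinorKernel {w : E m →ₗ[ℝ] Cl m} (hw : ∑ i, vec (e i) * w (e i) = 0) (a : ℤ) :
    ∑ i, lm i (spinorKernel a w (e i)) = 0 := by
  simp only [spinorKernel, LinearMap.comp_apply, lm_vmul, Finset.sum_sub_distrib,
    Finset.sum_neg_distrib, ← Finset.smul_sum, ← map_sum, sum_lm_scalarKernel hw,
    sum_imul_scalarKernel, map_smul, vmul_rmul, vmul_vmul, map_neg, rmul_rmul, sub_add_cancel]
  module

theorem diracEnd_rmul_vmul_lin {w : E m →ₗ[ℝ] Cl m} (hw : ∑ i, vec (e i) * w (e i) = 0)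
    (p : ℤ) :
    diracEnd pd lm (rmul p (vmul (lin w))) = (-(p + m + 2) : ℝ) • rmul p (lin w) := by
  rw [diracEnd_rmul_vmul, diracEnd_lin hw, euler_lin, map_zero, map_zero]
  module

theorem diracEnd_spinorKernel {w : E m →ₗ[ℝ] Cl m} (hw : ∑ i, vec (e i) * w (e i) = 0)
    (a : ℤ) (u : E m) :
    diracEnd pd lm (spinorKernel a w u) = (-(a + m) : ℝ) • scalarKernel a w u
      - (2 : ℝ) • rmul (a - 2) (lmul (vec u) (vmul (lin w))) := by
  have h : spinorKernel a w u = rmul a (vmul (const (w u)))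
      - (2 : ℝ) • rmul (a - 2) (vmul (imul u (lin w))) := by
    simp only [spinorKernel, LinearMap.comp_apply, scalarKernel_def, map_sub, map_smul, vmul_rmul]
  simp only [h, scalarKernel_def, map_sub, map_smul, diracEnd_rmul_vmul, diracEnd_const,
    diracEnd_imul, diracEnd_lin hw, euler_const, euler_imul, euler_lin, map_zero, map_add,
    lmul_vmul, map_neg]
  push_cast
  module

theorem fermionicEnd_spinorKernel {w : E m →ₗ[ℝ] Cl m} (hw : ∑ i, vec (e i) * w (e i) = 0)
    (n : ℕ) (hm : 0 < m) {a : ℤ} (ha : a = 2 * n - m) (u : E m) :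
    fermionicEnd pd lm (n + 1) (spinorKernel a w) u = 0 := by
  have hm' : (0 : ℝ) < m := by exact_mod_cast hm
  have hne : (m + 2 * (n + 1 : ℕ) - 2 : ℝ) ≠ 0 := by push_cast; ring_nf; positivity
  have ha' : (a : ℝ) = 2 * n - m := by rw [ha]; push_cast; ring
  have key : diracEnd pd lm (spinorKernel a w u) - (2 / (m + 2 * (n + 1 : ℕ) - 2) : ℝ) •
      lmul (vec u) (divEnd pd (spinorKernel a w)) = (-(2 * n) : ℝ) • scalarKernel a w u := by
    rw [diracEnd_spinorKernel hw, divEnd_spinorKernel hw, map_smul, lmul_rmul, smul_smul,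
      sub_sub, ← add_smul]
    -- Here `2m + a` equals the denominator `m + 2n`, so the two `u x w(x)` terms cancel and only
    -- the multiple of the scalar kernel survives.
    have : (2 + 2 / (m + 2 * (n + 1 : ℕ) - 2) * -(2 * m + a) : ℝ) = 0 := by
      rw [ha']
      push_cast at hne ⊢
      field_simp
      ring
    rw [this, ha', zero_smul, sub_zero]
    congr 1
    ring
  rw [fermionicEnd, Nat.add_sub_cancel, divEnd_lapEnd_pow, combEnd_lm, diracEnd_lapEnd_pow,
    lmul_lapEnd_pow, ← map_smul, ← map_sub, key]
  cases n with
  -- For the first-order operator both `-2n` and `4n` are zero, so the truncated exponent in the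
  -- last term is harmless.
  | zero => simp
  | succ n =>
    have hn : n + 1 + 1 - 2 = n := rfl
    have h0 := lapEnd_pow_lapEnd_scalarKernel_add n ha w u
    rw [map_add, map_smul] at h0
    rw [hn, divEnd_lapEnd_pow, combEnd_lapEnd_pow, divEnd_diracEnd, divEnd_spinorKernel hw]
    simp only [map_smul, diracEnd_rmul_vmul_lin hw, pow_succ, Module.End.mul_apply]
    have hd : (m + 2 * (n + 1 + 1 : ℕ) - 2 : ℝ) = m + 2 * n + 2 := by push_cast; ring
    have hne : (m + 2 * n + 2 : ℝ) ≠ 0 := by positivity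
    -- The divergence contributes `-(2m+a)`, which cancels the denominator, and the Dirac operator
    -- contributes `-(a+m)`. The last term thus becomes what is needed to complete a multiple of the
    -- bosonic identity `h0`.
    have hc : ((4 * (n + 1 + 1 : ℕ) - 4) / (m + 2 * (n + 1 + 1 : ℕ) - 2) *
        (-(2 * m + a) * -((a - 2 : ℤ) + m + 2)) : ℝ) = 2 * (n + 1 : ℕ) * (4 * (n + 1 : ℕ)) := by
      rw [hd]
      push_cast at ha' ⊢
      rw [ha']
      field_simp
      ring
    rw [eq_neg_of_add_eq_zero_left h0, smul_smul _ _ ((lapEnd pd ^ n) _), smul_smul, hc]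
    module

end Kernels

/-! ### Homogeneous and decaying functions -/

section Homogeneous

variable {m : ℕ}

/-- The smooth functions on the punctured space that are homogeneous of degree `d`. -/
def Homog (m : ℕ) (d : ℤ) : Submodule ℝ (SmoothFn (punctured m)) where
  carrier := {g | ∀ t : ℝ, 0 < t → ∀ x, g.1 (t • x) = t ^ d • g.1 x}
  add_mem' ha hb t ht x := by simp [ha t ht x, hb t ht x]
  zero_mem' t ht x := by simp
  smul_mem' c a ha t ht x := by simp [ha t ht x, smul_comm c]

theorem Homog.pd_mem {d : ℤ} {g : SmoothFn (punctured m)} (hg : g ∈ Homog m d) (i : Fin m) :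
    pd i g ∈ Homog m (d - 1) := by
  intro t ht x
  by_cases hx : x ∈ punctured m
  · have htx : t • x ∈ punctured m := smul_ne_zero ht.ne' hx
    rw [pd_apply i g hx, pd_apply i g htx, partialE, partialE, lineDeriv, lineDeriv]
    -- Rescaling the line parameter by `t⁻¹` is what lowers the degree by one.
    have h : ∀ s : ℝ, g.1 (t • x + s • e i) = t ^ d • g.1 (x + (t⁻¹ * s) • e i) := fun s => by
      rw [← hg t ht, smul_add, smul_smul, mul_inv_cancel_left₀ ht.ne']
    simp only [h]
    rw [deriv_fun_const_smul_field, deriv_comp_mul_left t⁻¹ (fun s => g.1 (x + s • e i)) 0, mul_zero,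
      smul_smul, zpow_sub_one₀ ht.ne']
  · have hx0 : x = 0 := not_not.1 hx
    have h0 : (pd i g).1 0 = 0 := (pd i g).2.2 0 fun h => h rfl
    simp [hx0, h0]

theorem Homog.lmul_mem {d : ℤ} {g : SmoothFn (punctured m)} (hg : g ∈ Homog m d) (a : Cl m) :
    lmul a g ∈ Homog m d := fun t ht x => by
  rw [lmul_apply, lmul_apply, hg t ht, mul_smul_comm]

theorem Homog.bound {d : ℤ} {g : SmoothFn (punctured m)} (hg : g ∈ Homog m d) :
    ∃ C : ℝ, ∀ x ≠ 0, ‖g.1 x‖ ≤ C * ‖x‖ ^ d := by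
  obtain ⟨C, hC⟩ := (isCompact_sphere (0 : E m) 1).exists_bound_of_continuousOn (f := g.1)
    (g.2.1.continuousOn.mono fun x hx => by
      rintro rfl
      simp at hx)
  refine ⟨C, fun x hx => ?_⟩
  have hn : 0 < ‖x‖ := norm_pos_iff.2 hx
  have h := hg ‖x‖ hn (‖x‖⁻¹ • x)
  rw [smul_smul, mul_inv_cancel₀ hn.ne', one_smul] at h
  rw [h, norm_smul, norm_zpow, norm_norm, mul_comm]
  gcongr
  exact hC _ (by simp [norm_smul, hn.ne'])

/-- The sums of homogeneous functions of degree at most `q`. -/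
def Decaying (m : ℕ) (q : ℤ) : Submodule ℝ (SmoothFn (punctured m)) :=
  ⨆ d : {d : ℤ // d ≤ q}, Homog m d

variable {q : ℤ}

theorem Homog.decaying {d : ℤ} (hd : d ≤ q) {g : SmoothFn (punctured m)} (hg : g ∈ Homog m d) :
    g ∈ Decaying m q :=
  Submodule.mem_iSup_of_mem (p := fun d : {d : ℤ // d ≤ q} => Homog m d) ⟨d, hd⟩ hg

theorem Decaying.pd_mem {g : SmoothFn (punctured m)} (hg : g ∈ Decaying m q) (i : Fin m) :
    pd i g ∈ Decaying m q := by
  refine Submodule.iSup_induction _ (motive := fun g => pd i g ∈ Decaying m q) hg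
    (fun d g hg => Homog.decaying (by have := d.2; omega) (Homog.pd_mem hg i)) (by simp) ?_
  intro f g hf hg
  rw [map_add]
  exact add_mem hf hg

theorem Decaying.lmul_mem {g : SmoothFn (punctured m)} (hg : g ∈ Decaying m q) (a : Cl m) :
    lmul a g ∈ Decaying m q := by
  refine Submodule.iSup_induction _ (motive := fun g => lmul a g ∈ Decaying m q) hg
    (fun d g hg => Homog.decaying d.2 (Homog.lmul_mem hg a)) (by simp) ?_
  intro f g hf hg
  rw [map_add]
  exact add_mem hf hg

/-- Different degrees may be mixed, so the comparison with `‖x‖^q` is valid only away from the unit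
ball. -/
theorem Decaying.bound {g : SmoothFn (punctured m)} (hg : g ∈ Decaying m q) :
    ∃ C : ℝ, ∀ x, 1 ≤ ‖x‖ → ‖g.1 x‖ ≤ C * ‖x‖ ^ q := by
  refine Submodule.iSup_induction _
    (motive := fun g : SmoothFn (punctured m) => ∃ C : ℝ, ∀ x, 1 ≤ ‖x‖ → ‖g.1 x‖ ≤ C * ‖x‖ ^ q) hg
    ?_ ⟨0, by simp⟩ ?_
  · rintro ⟨d, hd⟩ g hg
    obtain ⟨C, hC⟩ := Homog.bound hg
    refine ⟨|C|, fun x hx => (hC x (by rintro rfl; simp at hx; linarith)).trans ?_⟩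
    gcongr
    exact le_abs_self C
  · rintro f g ⟨C, hC⟩ ⟨C', hC'⟩
    refine ⟨C + C', fun x hx => (norm_add_le _ _).trans ?_⟩
    rw [add_mul]
    exact add_le_add (hC x hx) (hC' x hx)

/-- The partial derivatives of decaying functions. -/
def decayPd (i : Fin m) : Module.End ℝ (Decaying m q) :=
  (pd i).restrict fun _ hg => Decaying.pd_mem hg i

/-- Left multiplication of decaying functions by `e_i`. -/
def decayLm (i : Fin m) : Module.End ℝ (Decaying m q) :=
  (lm i).restrict fun _ hg => Decaying.lmul_mem hg _

end Homogeneous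

/-! ### Series over the lattice -/

section Lattice

variable {m l : ℕ}

theorem isClosed_lattice (m l : ℕ) : IsClosed (lattice m l : Set (E m)) := by
  have h : (lattice m l : Set (E m)) = ⋂ j : Fin m, (fun x : E m => x j) ⁻¹'
      (if (j : ℕ) < l then Set.range ((↑) : ℤ → ℝ) else {0}) := by
    ext x
    simp only [Set.mem_iInter, Set.mem_preimage, SetLike.mem_coe]
    constructor
    · rintro ⟨n, rfl⟩ j
      by_cases hj : (j : ℕ) < l <;> simp [latticeVec, hj]
    · intro hx
      have hx' : ∀ j : Fin m, (j : ℕ) < l → ∃ a : ℤ, (a : ℝ) = x j := fun j hj => by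
        simpa [hj] using hx j
      choose a ha using hx'
      -- The value `0` only serves indices beyond `m`, which `latticeVec` ignores.
      refine ⟨fun i => if h : (i : ℕ) < m then a ⟨i, h⟩ i.2 else 0, ?_⟩
      ext j
      by_cases hj : (j : ℕ) < l
      · simp [latticeVec, hj, ha]
      · have := hx j
        simp only [hj, if_false, Set.mem_singleton_iff] at this
        simp [latticeVec, hj, this]
  rw [h]
  refine isClosed_iInter fun j => IsClosed.preimage (by fun_prop) ?_
  split_ifs
  · exact Int.isClosedEmbedding_coe_real.isClosed_range
  · exact isClosed_singleton

/-- The open set `ℝ^m \ ℤ^l`. -/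
def latticeCompl (m l : ℕ) : TopologicalSpace.Opens (E m) :=
  ⟨(lattice m l : Set (E m))ᶜ, (isClosed_lattice m l).isOpen_compl⟩

theorem add_latticeVec_mem_punctured {x : E m} (hx : x ∈ latticeCompl m l) (n : Fin l → ℤ) :
    x + latticeVec m l n ∈ punctured m := by
  intro h
  have h : x + latticeVec m l n = 0 := h
  exact hx ⟨-n, by rw [map_neg]; exact (eq_neg_of_add_eq_zero_left h).symm⟩

theorem norm_le_norm_latticeVec (hlm : l ≤ m) (n : Fin l → ℤ) : ‖n‖ ≤ ‖latticeVec m l n‖ := by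
  refine (pi_norm_le_iff_of_nonneg (norm_nonneg _)).2 fun i => ?_
  have h := PiLp.norm_apply_le (latticeVec m l n) ⟨i, i.2.trans_le hlm⟩
  simpa [latticeVec, Int.norm_eq_abs] using h

/-- The exponent lies below `-l`, minus the rank of the lattice; the sum is transported from the
`ℤ`-span of the standard basis of `ℝ^l` with the sup norm. -/
theorem summable_norm_zpow (l : ℕ) :
    Summable fun n : Fin l → ℤ => ‖n‖ ^ (-(l + 1) : ℤ) := by
  let b := Pi.basisFun ℝ (Fin l)
  let L := Submodule.span ℤ (Set.range b)
  have hmem : ∀ n : Fin l → ℤ, (fun i => (n i : ℝ)) ∈ L := fun n => by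
    have : (fun i => (n i : ℝ)) = ∑ i, n i • b i := by
      ext j
      simp [b, Pi.single_apply]
    rw [this]
    exact Submodule.sum_mem _ fun i _ =>
      Submodule.smul_mem _ _ (Submodule.subset_span (Set.mem_range_self i))
  have hrank : Module.finrank ℤ L = l := by
    rw [ZLattice.rank ℝ L]
    simp
  have hs := ZLattice.summable_norm_zpow L (-(l + 1)) (by rw [hrank]; omega)
  have hinj : Function.Injective fun n : Fin l → ℤ => (⟨_, hmem n⟩ : L) := by
    intro a c h
    funext i
    have h' : ((a i : ℤ) : ℝ) = c i := congrFun (congrArg Subtype.val h) i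
    exact_mod_cast h'
  refine (hs.comp_injective hinj).congr fun n => ?_
  have : ‖(fun i => (n i : ℝ))‖ = ‖n‖ := by
    simp only [Pi.norm_def]
    rfl
  simp only [Function.comp_apply]
  rw [← this]
  rfl

theorem exists_summable_bound (hlm : l ≤ m) {g : SmoothFn (punctured m)}
    (hg : g ∈ Decaying m (-(l + 1))) {K : Set (E m)} (hK : IsCompact K)
    (hKs : K ⊆ latticeCompl m l) :
    ∃ M : (Fin l → ℤ) → ℝ, Summable M ∧ ∀ n, ∀ x ∈ K, ‖g.1 (x + latticeVec m l n)‖ ≤ M n := by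
  obtain ⟨C, hC⟩ := Decaying.bound hg
  obtain ⟨R, hR⟩ := hK.isBounded.exists_norm_le
  have hb : ∀ n, ∃ b : ℝ, ∀ x ∈ K, ‖g.1 (x + latticeVec m l n)‖ ≤ b := fun n =>
    hK.exists_bound_of_continuousOn (g.2.1.continuousOn.comp (by fun_prop)
      fun x hx => add_latticeVec_mem_punctured (hKs hx) n)
  choose b hb using hb
  -- Beyond this threshold `‖x + n‖ ≥ ‖n‖/2 ≥ 1` on `K`, so the decay bound applies. The finitely
  -- many other terms are bounded by compactness. The absolute value covers a negative `R`, possible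
  -- when `K` is empty.
  refine ⟨fun n => if 2 * |R| + 2 ≤ ‖n‖ then |C| * 2 ^ (l + 1) * ‖n‖ ^ (-(l + 1) : ℤ) else b n,
    ?_, ?_⟩
  · refine ((summable_norm_zpow l).mul_left (|C| * 2 ^ (l + 1))).congr_cofinite ?_
    have hfin : (Metric.closedBall (0 : Fin l → ℤ) (2 * |R| + 2)).Finite :=
      (isCompact_closedBall _ _).finite_of_discrete
    filter_upwards [hfin.compl_mem_cofinite] with n hn
    rw [if_pos]
    simp only [Set.mem_compl_iff, mem_closedBall_zero_iff, not_le] at hn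
    exact hn.le
  · intro n x hx
    dsimp only
    split_ifs with hn
    · have h1 := norm_le_norm_latticeVec (m := m) hlm n
      have h2 : ‖latticeVec m l n‖ - ‖x‖ ≤ ‖x + latticeVec m l n‖ := by
        have := norm_sub_norm_le (latticeVec m l n) (-x)
        rwa [norm_neg, sub_neg_eq_add, add_comm (latticeVec m l n)] at this
      have h3 : ‖x‖ ≤ |R| := (hR x hx).trans (le_abs_self R)
      have h4 : ‖n‖ / 2 ≤ ‖x + latticeVec m l n‖ := by linarith
      have h5 : 0 < ‖n‖ / 2 := by linarith [abs_nonneg R]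
      refine (hC _ (by linarith [abs_nonneg R])).trans ?_
      rw [mul_assoc]
      have h6 : (2 : ℝ) ^ (l + 1) * ‖n‖ ^ (-(l + 1) : ℤ) = (‖n‖ / 2) ^ (-(l + 1) : ℤ) := by
        rw [div_zpow, zpow_neg 2, div_inv_eq_mul, mul_comm]
        norm_cast
      rw [h6, zpow_neg, zpow_neg]
      have h7 : ((‖x + latticeVec m l n‖) ^ ((l : ℤ) + 1))⁻¹ ≤ ((‖n‖ / 2) ^ ((l : ℤ) + 1))⁻¹ := by
        refine inv_anti₀ (by positivity) ?_
        exact_mod_cast pow_le_pow_left₀ h5.le h4 (l + 1)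
      calc _ ≤ |C| * ((‖x + latticeVec m l n‖) ^ ((l : ℤ) + 1))⁻¹ := by
            gcongr
            exact le_abs_self C
        _ ≤ _ := by gcongr
    · exact hb n x hx

/-- The sum of a function over the lattice translates of a point. -/
def latticeSum (l : ℕ) (g : E m → Cl m) (x : E m) : Cl m :=
  ∑' n : Fin l → ℤ, g (x + latticeVec m l n)

theorem summable_latticeVec (hlm : l ≤ m) {g : SmoothFn (punctured m)}
    (hg : g ∈ Decaying m (-(l + 1))) {x : E m} (hx : x ∈ latticeCompl m l) :
    Summable fun n : Fin l → ℤ => g.1 (x + latticeVec m l n) := by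
  obtain ⟨M, hM, hb⟩ := exists_summable_bound hlm hg isCompact_singleton
    (Set.singleton_subset_iff.2 hx)
  exact Summable.of_norm_bounded hM fun n => hb n x rfl

theorem clm_norm_le_sum (T : E m →L[ℝ] Cl m) : ‖T‖ ≤ ∑ i, ‖T (e i)‖ := by
  refine T.opNorm_le_bound (Finset.sum_nonneg fun _ _ => norm_nonneg _) fun v => ?_
  calc ‖T v‖ = ‖∑ i, v i • T (e i)‖ := by
        conv_lhs => rw [← sum_smul_e v]
        simp
    _ ≤ ∑ i, ‖T (e i)‖ * ‖v‖ := norm_sum_le_of_le _ fun i _ => by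
        rw [norm_smul, mul_comm]
        gcongr
        exact PiLp.norm_apply_le v i
    _ = _ := (Finset.sum_mul _ _ _).symm

/-- Termwise differentiation: the partial derivatives decay at the same rate, so the series of
derivatives is dominated on a small ball. Expressing the result through sums of the same type drives
the induction for smoothness. -/
theorem hasFDerivAt_latticeSum (hlm : l ≤ m) {g : SmoothFn (punctured m)}
    (hg : g ∈ Decaying m (-(l + 1))) {x : E m} (hx : x ∈ latticeCompl m l) :
    ∃ T : E m →L[ℝ] Cl m, HasFDerivAt (latticeSum l g.1) T x ∧
      ∀ v, T v = ∑ i, v i • latticeSum l (pd i g).1 x := by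
  obtain ⟨r, hr, hball⟩ := Metric.nhds_basis_closedBall.mem_iff.1
    ((latticeCompl m l).isOpen.mem_nhds hx)
  have hM := fun i : Fin m => exists_summable_bound hlm (Decaying.pd_mem hg i)
    (isCompact_closedBall x r) hball
  choose M hM hb using hM
  have hsub : Metric.ball x r ⊆ latticeCompl m l := Metric.ball_subset_closedBall.trans hball
  have hbd : ∀ n : Fin l → ℤ, ∀ y ∈ Metric.ball x r,
      ‖fderiv ℝ g.1 (y + latticeVec m l n)‖ ≤ ∑ i, M i n := fun n y hy => by
    refine (clm_norm_le_sum _).trans (Finset.sum_le_sum fun i _ => ?_)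
    have hp := add_latticeVec_mem_punctured (hsub hy) n
    rw [← partialE_eq g hp, ← pd_apply i g hp]
    exact hb i n y (Metric.ball_subset_closedBall hy)
  have hsum : Summable fun n => ∑ i, M i n := summable_sum fun i _ => hM i
  have hxb := Metric.mem_ball_self (x := x) hr
  refine ⟨∑' n : Fin l → ℤ, fderiv ℝ g.1 (x + latticeVec m l n),
    hasFDerivAt_tsum_of_isPreconnected hsum Metric.isOpen_ball
      (convex_ball x r).isPreconnected (fun n y hy => ?_) hbd hxb
      (summable_latticeVec hlm hg hx) hxb, fun v => ?_⟩
  · have hd := differentiableAt g (add_latticeVec_mem_punctured (hsub hy) n)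
    exact (hasFDerivAt_comp_add_right (latticeVec m l n)).2 hd.hasFDerivAt
  · have hs : Summable fun n : Fin l → ℤ => fderiv ℝ g.1 (x + latticeVec m l n) :=
      Summable.of_norm_bounded hsum fun n => hbd n x hxb
    have h1 : ∀ i, (∑' n : Fin l → ℤ, fderiv ℝ g.1 (x + latticeVec m l n)) (e i) =
        latticeSum l (pd i g).1 x := fun i => by
      rw [← ContinuousLinearMap.apply_apply (e i) (∑' n : Fin l → ℤ, _),
        ContinuousLinearMap.map_tsum _ hs]
      refine tsum_congr fun n => ?_
      have hp := add_latticeVec_mem_punctured hx n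
      rw [pd_apply i g hp, partialE_eq g hp]
      rfl
    conv_lhs => rw [← sum_smul_e v]
    simp only [map_sum, map_smul, h1]

theorem contDiffOn_latticeSum (hlm : l ≤ m) {g : SmoothFn (punctured m)}
    (hg : g ∈ Decaying m (-(l + 1))) : ContDiffOn ℝ ∞ (latticeSum l g.1) (latticeCompl m l) := by
  refine contDiffOn_infty.2 fun N => ?_
  induction N generalizing g with
  | zero =>
    refine contDiffOn_zero.2 fun x hx => ?_
    obtain ⟨T, hT, -⟩ := hasFDerivAt_latticeSum hlm hg hx
    exact hT.continuousAt.continuousWithinAt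
  | succ N ih =>
    rw [Nat.cast_succ]
    refine (contDiffOn_succ_iff_fderiv_of_isOpen (latticeCompl m l).isOpen).2
      ⟨fun x hx => ?_, fun h => absurd h (by simp), contDiffOn_clm_apply.2 fun v => ?_⟩
    · obtain ⟨T, hT, -⟩ := hasFDerivAt_latticeSum hlm hg hx
      exact hT.differentiableAt.differentiableWithinAt
    · refine ContDiffOn.congr (f := fun x => ∑ i, v i • latticeSum l (pd i g).1 x)
        (ContDiffOn.sum fun i _ => (ih (Decaying.pd_mem hg i)).const_smul (v i)) ?_
      intro x hx
      obtain ⟨T, hT, hT'⟩ := hasFDerivAt_latticeSum hlm hg hx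
      rw [hT.fderiv, hT']

/-- Summation over the lattice, as a linear map. -/
def periodize (hlm : l ≤ m) : Decaying m (-(l + 1)) →ₗ[ℝ] SmoothFn (latticeCompl m l) where
  toFun g := trunc (latticeSum l g.1.1) (contDiffOn_latticeSum hlm g.2)
  map_add' f g := ext_on fun x hx => by
    simp only [Submodule.coe_add, Pi.add_apply, trunc_apply _ hx, latticeSum]
    exact (summable_latticeVec hlm f.2 hx).tsum_add (summable_latticeVec hlm g.2 hx)
  map_smul' c f := ext_on fun x hx => by
    simp only [Submodule.coe_smul, Pi.smul_apply, trunc_apply _ hx, latticeSum, RingHom.id_apply]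
    exact (summable_latticeVec hlm f.2 hx).tsum_const_smul c

theorem periodize_apply (hlm : l ≤ m) (g : Decaying m (-(l + 1))) {x : E m}
    (hx : x ∈ latticeCompl m l) : (periodize hlm g).1 x = latticeSum l g.1.1 x :=
  trunc_apply (contDiffOn_latticeSum hlm g.2) hx

theorem periodize_pd (hlm : l ≤ m) (i : Fin m) (g : Decaying m (-(l + 1))) :
    periodize hlm (decayPd i g) = pd i (periodize hlm g) := by
  refine ext_on fun x hx => ?_
  rw [periodize_apply hlm _ hx, ← partialE_congr (fun z hz => (periodize_apply hlm g hz).symm) i hx]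
  obtain ⟨T, hT, hT'⟩ := hasFDerivAt_latticeSum hlm g.2 hx
  rw [partialE, (hT.hasLineDerivAt (e i)).lineDeriv, hT']
  simp only [e_apply, ite_smul, one_smul, zero_smul, Finset.sum_ite_eq', Finset.mem_univ, if_true]
  rfl

theorem periodize_lm (hlm : l ≤ m) (i : Fin m) (g : Decaying m (-(l + 1))) :
    periodize hlm (decayLm i g) = lm i (periodize hlm g) := by
  refine ext_on fun x hx => ?_
  rw [lmul_apply, periodize_apply hlm _ hx, periodize_apply hlm _ hx]
  exact ((LinearMap.toContinuousLinearMap (LinearMap.mulLeft ℝ (vec (e i)))).map_tsum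
    (summable_latticeVec hlm g.2 hx)).symm

/-- Periodization preserves the solutions of `𝒟_{1,k}`. -/
theorem higherSpinEnd_periodize (hlm : l ≤ m) (k : ℕ) (b : E m → Decaying m (-(l + 1))) (u : E m)
    (hb : higherSpinEnd pd lm k (fun w => (b w).1) u = 0) :
    higherSpinEnd pd lm k (fun w => periodize hlm (b w)) u = 0 := by
  rw [← map_higherSpinEnd (N := Decaying m (-(l + 1))) (D := decayPd) (L := decayLm)
    (T := periodize hlm) (periodize_pd hlm) (periodize_lm hlm) k b u]
  have h := map_higherSpinEnd (N := Decaying m (-(l + 1)))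
    (T := (Decaying m (-(l + 1))).subtype) (D := decayPd) (D' := pd)
    (L := decayLm) (L' := lm) (fun _ _ => rfl) (fun _ _ => rfl) k b u
  have h0 : higherSpinEnd (N := Decaying m (-(l + 1))) decayPd decayLm k b u = 0 :=
    Subtype.ext (h.trans hb)
  rw [h0, map_zero]

end Lattice

/-! ### Second moments of the sphere -/

open MeasureTheory

section Sphere

variable {m : ℕ}

/-- The surface measure of the unit sphere. -/
abbrev surface (m : ℕ) : Measure (Metric.sphere (0 : E m) 1) := (volume : Measure (E m)).toSphere

/-- The map of the unit sphere induced by a linear isometry. -/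
def sphereMap (T : E m ≃ₗᵢ[ℝ] E m) (u : Metric.sphere (0 : E m) 1) : Metric.sphere (0 : E m) 1 :=
  ⟨T u, by simp⟩

theorem continuous_sphereMap (T : E m ≃ₗᵢ[ℝ] E m) : Continuous (sphereMap T) :=
  (T.continuous.comp continuous_subtype_val).subtype_mk _

-- Surface measure of a set is, up to a constant, the volume of the cone over it, and a linear
-- isometry preserves volume and carries cones to cones.
open scoped Pointwise in
theorem measurePreserving_sphereMap (T : E m ≃ₗᵢ[ℝ] E m) :
    MeasurePreserving (sphereMap T) (surface m) (surface m) := by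
  refine ⟨(continuous_sphereMap T).measurable, ?_⟩
  ext s hs
  have hms := (continuous_sphereMap T).measurable hs
  rw [Measure.map_apply (continuous_sphereMap T).measurable hs, Measure.toSphere_apply' _ hs,
    Measure.toSphere_apply' _ hms,
    ← T.measurePreserving.measure_preimage_emb T.toHomeomorph.measurableEmbedding
      (Set.Ioo (0 : ℝ) 1 • (Subtype.val '' s))]
  congr 2
  ext x
  simp only [Set.mem_smul, Set.mem_image, Set.mem_preimage]
  constructor
  · rintro ⟨r, hr, _, ⟨u, hu, rfl⟩, rfl⟩
    exact ⟨r, hr, _, ⟨_, hu, rfl⟩, by simp [sphereMap]⟩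
  · rintro ⟨r, hr, _, ⟨u, hu, rfl⟩, h⟩
    refine ⟨r, hr, T.symm u, ⟨⟨T.symm u, by simp⟩, ?_, rfl⟩, ?_⟩
    · convert hu
      exact Subtype.ext (T.apply_symm_apply u)
    · apply T.injective
      rw [map_smul, T.apply_symm_apply]
      exact h

theorem integral_sphereMap (T : E m ≃ₗᵢ[ℝ] E m) {f : Metric.sphere (0 : E m) 1 → ℝ}
    (hf : Continuous f) : ∫ u, f (sphereMap T u) ∂surface m = ∫ u, f u ∂surface m := by
  conv_rhs => rw [← (measurePreserving_sphereMap T).map_eq]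
  exact (integral_map (continuous_sphereMap T).aemeasurable hf.aestronglyMeasurable).symm

theorem continuous_coord_mul (i j : Fin m) :
    Continuous fun u : Metric.sphere (0 : E m) 1 => (u : E m) i * (u : E m) j := by
  fun_prop

/-- The common value of the integrals `∫ u_i²` over the unit sphere. -/
def sphereMoment (m : ℕ) : ℝ := (surface m).real Set.univ / m

theorem sphereMoment_ne_zero (hm : 0 < m) : sphereMoment m ≠ 0 := by
  have : Nonempty (Fin m) := ⟨⟨0, hm⟩⟩
  have h : surface m ≠ 0 := Measure.toSphere_ne_zero _
  refine div_ne_zero ?_ (by exact_mod_cast hm.ne')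
  rw [Measure.real, ENNReal.toReal_ne_zero]
  exact ⟨fun h' => h (Measure.measure_univ_eq_zero.1 h'), measure_ne_top _ _⟩

theorem integral_coord_mul_of_ne {i j : Fin m} (hij : i ≠ j) :
    ∫ u : Metric.sphere (0 : E m) 1, (u : E m) i * (u : E m) j ∂surface m = 0 := by
  -- The reflection in the `i`-th coordinate changes the sign of the integrand.
  let T : E m ≃ₗᵢ[ℝ] E m := LinearIsometryEquiv.piLpCongrRight 2 fun k =>
    if k = i then LinearIsometryEquiv.neg ℝ else LinearIsometryEquiv.refl ℝ ℝ
  have h := integral_sphereMap T (continuous_coord_mul i j)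
  have hT : ∀ u, ((sphereMap T u : Metric.sphere (0 : E m) 1) : E m) i *
      ((sphereMap T u : Metric.sphere (0 : E m) 1) : E m) j = -((u : E m) i * (u : E m) j) := by
    intro u
    simp [sphereMap, T, hij.symm]
  simp only [hT, integral_neg] at h
  linarith

theorem integral_coord_sq_eq (i j : Fin m) :
    ∫ u : Metric.sphere (0 : E m) 1, (u : E m) i * (u : E m) i ∂surface m =
      ∫ u : Metric.sphere (0 : E m) 1, (u : E m) j * (u : E m) j ∂surface m := by
  rw [← integral_sphereMap (LinearIsometryEquiv.piLpCongrLeft 2 ℝ ℝ (Equiv.swap i j))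
    (continuous_coord_mul i i)]
  simp [sphereMap]

theorem integrable_coord_mul (i j : Fin m) :
    Integrable (fun u : Metric.sphere (0 : E m) 1 => (u : E m) i * (u : E m) j) (surface m) :=
  (continuous_coord_mul i j).integrable_of_hasCompactSupport (HasCompactSupport.of_compactSpace _)

theorem integral_coord_mul (i j : Fin m) :
    ∫ u : Metric.sphere (0 : E m) 1, (u : E m) i * (u : E m) j ∂surface m =
      if i = j then sphereMoment m else 0 := by
  split_ifs with hij
  · subst hij
    have hm : (m : ℝ) ≠ 0 := by exact_mod_cast (Fin.pos i).ne'
    rw [sphereMoment, eq_div_iff hm]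
    -- The `m` second moments are equal and add up to the total mass, as `∑ u_j² = 1` on the sphere.
    have h1 : ∑ j : Fin m, ∫ u : Metric.sphere (0 : E m) 1, (u : E m) j * (u : E m) j ∂surface m =
        (surface m).real Set.univ := by
      rw [← integral_finsetSum _ fun j _ => integrable_coord_mul j j]
      simp [sum_sq_eq]
    rw [← h1, Finset.sum_congr rfl fun j _ => integral_coord_sq_eq j i]
    simp [mul_comm]
  · exact integral_coord_mul_of_ne hij

theorem integral_bilinear (B : E m →ₗ[ℝ] E m →ₗ[ℝ] Cl m) :
    ∫ u : Metric.sphere (0 : E m) 1, B u u ∂surface m = sphereMoment m • ∑ i, B (e i) (e i) := by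
  have h : ∀ u : Metric.sphere (0 : E m) 1, B u u =
      ∑ i, ∑ j, ((u : E m) i * (u : E m) j) • B (e i) (e j) := fun u => by
    conv_lhs => rw [← sum_smul_e (u : E m)]
    simp only [map_sum, LinearMap.sum_apply, map_smul, LinearMap.smul_apply, Finset.smul_sum,
      smul_smul]
    rw [Finset.sum_comm]
    simp only [mul_comm]
  simp only [h]
  rw [integral_finsetSum _ fun i _ => integrable_finsetSum _ fun j _ =>
    (integrable_coord_mul i j).smul_const _, Finset.smul_sum]
  refine Finset.sum_congr rfl fun i _ => ?_
  rw [integral_finsetSum _ fun j _ => (integrable_coord_mul i j).smul_const _]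
  simp [integral_smul_const, integral_coord_mul]

end Sphere

/-! ### The reproducing kernel -/

section Kernel

variable {m : ℕ}

theorem IsHomogeneousDegreeOne.exists_linear {f : E m → Cl m} (hf : IsHomogeneousDegreeOne f) :
    ∃ T : E m →ₗ[ℝ] Cl m, f = T := by
  obtain ⟨a, ha⟩ := hf
  refine ⟨{ toFun := f, map_add' := fun u v => ?_, map_smul' := fun c u => ?_ }, rfl⟩
  · simp [ha, add_smul, Finset.sum_add_distrib]
  · simp [ha, Finset.smul_sum, smul_smul]

theorem isHomogeneousDegreeOne_linear (T : E m →ₗ[ℝ] Cl m) : IsHomogeneousDegreeOne T :=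
  ⟨fun i => T (e i), fun u => (sum_smul_map_e T u).symm⟩

theorem isSpinOne_linear_iff (k : ℕ) (T : E m →ₗ[ℝ] Cl m) :
    IsSpinOne k T ↔ (¬Even k → ∑ i, vec (e i) * T (e i) = 0) := by
  have h1 : ∀ i, partialE i T = fun _ => T (e i) := fun i => funext fun u => partialE_linear T i u
  have h2 : ∀ (i : Fin m) (c : Cl m) u, partialE i (fun _ => c) u = 0 := fun i c u =>
    ((hasFDerivAt_const c u).hasLineDerivAt (e i)).lineDeriv
  by_cases hk : Even k <;> simp [IsSpinOne, hk, h1, h2, isHomogeneousDegreeOne_linear]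

theorem IsSpinOne.exists_linear {k : ℕ} {f : E m → Cl m} (hf : IsSpinOne k f) :
    ∃ T : E m →ₗ[ℝ] Cl m, f = T ∧ (¬Even k → ∑ i, vec (e i) * T (e i) = 0) := by
  obtain ⟨T, rfl⟩ := hf.1.exists_linear
  exact ⟨T, rfl, (isSpinOne_linear_iff k T).1 hf⟩

/-- Clifford conjugation as a linear map. -/
def starLin (m : ℕ) : Cl m →ₗ[ℝ] Cl m where
  toFun := star
  map_add' := star_add
  map_smul' c x := CliffordAlgebra.star_smul c x

theorem integral_star_mul (T S : E m →ₗ[ℝ] Cl m) :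
    ∫ u : Metric.sphere (0 : E m) 1, star (T u) * S u ∂surface m =
      sphereMoment m • ∑ i, star (T (e i)) * S (e i) :=
  integral_bilinear ((LinearMap.mul ℝ (Cl m)).compl₁₂ (starLin m ∘ₗ T) S)

/-- The reproducing kernel, as a linear map in `u`. -/
def kernelLin (k : ℕ) (v : E m) : E m →ₗ[ℝ] Cl m :=
  (sphereMoment m)⁻¹ • ((innerₗ (E m) v).smulRight (1 : Cl m) +
    if Even k then 0 else (m : ℝ)⁻¹ • (LinearMap.mulRight ℝ (vec v) ∘ₗ CliffordAlgebra.ι (negSq m)))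

theorem sum_vec_mul_vec (m : ℕ) : ∑ i : Fin m, vec (e i) * vec (e i) = -(m : ℝ) • (1 : Cl m) := by
  have h : ∀ i : Fin m, ‖e i‖ = 1 := fun i => by simp [e]
  simp only [vec_mul_self, h]
  simp [Algebra.algebraMap_eq_smul_one, Nat.cast_smul_eq_nsmul]

/-- The weight `1/m` of the correction `uv` is forced by `∑ e_i² = -m`. -/
theorem sum_vec_mul_kernelLin (hm : 0 < m) {k : ℕ} (hk : ¬Even k) (v : E m) :
    ∑ i, vec (e i) * kernelLin k v (e i) = 0 := by
  have hm' : (m : ℝ) ≠ 0 := by exact_mod_cast hm.ne'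
  have h : ∀ i : Fin m, vec (e i) * kernelLin k v (e i) = (sphereMoment m)⁻¹ • (v i • vec (e i) +
      (m : ℝ)⁻¹ • (vec (e i) * vec (e i) * vec v)) := by
    intro i
    rw [mul_assoc]
    simp [kernelLin, hk, inner_e, mul_add]
  rw [Finset.sum_congr rfl fun i _ => h i, ← Finset.smul_sum, Finset.sum_add_distrib,
    sum_smul_vec, ← Finset.smul_sum, ← Finset.sum_mul, sum_vec_mul_vec, smul_mul_assoc, one_mul,
    smul_smul]
  simp [hm']

theorem star_kernelLin (k : ℕ) (v : E m) (i : Fin m) :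
    star (kernelLin k v (e i)) = (sphereMoment m)⁻¹ • (v i • (1 : Cl m) +
      if Even k then 0 else (m : ℝ)⁻¹ • (vec v * vec (e i))) := by
  split_ifs with hk <;>
    simp [kernelLin, hk, inner_e, CliffordAlgebra.star_smul, CliffordAlgebra.star_ι]

/-- The term `⟨u,v⟩` alone reproduces every linear map; for odd `k` the correction pairs to `v ∑ e_i
T(e_i)`, which is zero. -/
theorem reproducing_kernelLin (hm : 0 < m) {k : ℕ} {T : E m →ₗ[ℝ] Cl m}
    (hT : ¬Even k → ∑ i, vec (e i) * T (e i) = 0) (v : E m) :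
    sphereMoment m • ∑ i, star (kernelLin k v (e i)) * T (e i) = T v := by
  simp only [star_kernelLin, smul_mul_assoc, ← Finset.smul_sum]
  rw [smul_inv_smul₀ (sphereMoment_ne_zero hm)]
  simp only [add_mul, Finset.sum_add_distrib, smul_mul_assoc, one_mul, sum_smul_map_e]
  split_ifs with hk
  · simp
  · simp only [smul_mul_assoc, mul_assoc, ← Finset.smul_sum, ← Finset.mul_sum, hT hk]
    simp

theorem isSpinOne_kernelLin (hm : 0 < m) (k : ℕ) (v : E m) : IsSpinOne k (kernelLin k v) :=
  (isSpinOne_linear_iff k _).2 fun hk => sum_vec_mul_kernelLin hm hk v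

theorem isReproducingKernel_kernelLin (hm : 0 < m) (k : ℕ) :
    IsReproducingKernel m k fun u v => kernelLin k v u where
  mem := isSpinOne_kernelLin hm k
  reproducing f hf v := by
    obtain ⟨T, rfl, hT⟩ := hf.exists_linear
    exact (integral_star_mul (kernelLin k v) T).trans (reproducing_kernelLin hm hT v)

/-- Pairing the two kernels with each other and evaluating by either reproducing property gives
conjugate answers. Applying this also to the explicit kernel itself yields uniqueness. -/
theorem IsReproducingKernel.eq_star (hm : 0 < m) {k : ℕ} {Z : E m → E m → Cl m}
    (hZ : IsReproducingKernel m k Z) (u v : E m) : Z u v = star (kernelLin k u v) := by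
  obtain ⟨T, hT, hT'⟩ := (hZ.mem v).exists_linear
  have h1 := hZ.reproducing _ (isSpinOne_kernelLin hm k u) v
  simp only [fun w => congrFun hT w] at h1
  rw [integral_star_mul] at h1
  rw [congrFun hT u, ← reproducing_kernelLin hm hT' u, ← h1, CliffordAlgebra.star_smul, star_sum]
  simp only [star_mul, star_star]

theorem IsReproducingKernel.eq_kernelLin (hm : 0 < m) {k : ℕ} {Z : E m → E m → Cl m}
    (hZ : IsReproducingKernel m k Z) : Z = fun u v => kernelLin k v u := by
  funext u v
  rw [hZ.eq_star hm, ← (isReproducingKernel_kernelLin hm k).eq_star hm u v]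

end Kernel

/-! ### The fundamental solution and its periodization -/

section Homogeneity

variable {m : ℕ} {d : ℤ}

theorem Homog.of_ne_zero {g : SmoothFn (punctured m)}
    (h : ∀ t : ℝ, 0 < t → ∀ x ≠ 0, g.1 (t • x) = t ^ d • g.1 x) : g ∈ Homog m d := by
  intro t ht x
  by_cases hx : x = 0
  · have h0 : g.1 0 = 0 := g.2.2 0 fun h => h rfl
    rw [hx, smul_zero, h0, smul_zero]
  · exact h t ht x hx

theorem Homog.const_mem (c : Cl m) : const c ∈ Homog m 0 :=
  Homog.of_ne_zero fun t ht x hx => by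
    rw [const_apply c (mem_punctured.2 (smul_ne_zero ht.ne' hx)), const_apply c hx]
    simp

theorem Homog.lin_mem (w : E m →ₗ[ℝ] Cl m) : lin w ∈ Homog m 1 :=
  Homog.of_ne_zero fun t ht x hx => by
    rw [lin_apply w (mem_punctured.2 (smul_ne_zero ht.ne' hx)), lin_apply w hx]
    simp

theorem Homog.imul_mem {g : SmoothFn (punctured m)} (hg : g ∈ Homog m d) (u : E m) :
    imul u g ∈ Homog m (d + 1) := fun t ht x => by
  rw [imul_apply, imul_apply, hg t ht, inner_smul_left, zpow_add_one₀ ht.ne', smul_smul, smul_smul]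
  simp only [conj_trivial]
  ring_nf

theorem Homog.vmul_mem {g : SmoothFn (punctured m)} (hg : g ∈ Homog m d) :
    vmul g ∈ Homog m (d + 1) := fun t ht x => by
  rw [vmul_apply, vmul_apply, hg t ht, vec, map_smul, zpow_add_one₀ ht.ne', smul_mul_smul_comm,
    mul_comm t]

theorem Homog.rmul_mem {g : SmoothFn (punctured m)} (hg : g ∈ Homog m d) (p : ℤ) :
    rmul p g ∈ Homog m (p + d) := fun t ht x => by
  rw [rmul_apply, rmul_apply, hg t ht, norm_smul, Real.norm_of_nonneg ht.le, mul_zpow,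
    zpow_add₀ ht.ne', smul_smul, smul_smul]
  ring_nf

theorem scalarKernel_mem (a : ℤ) (w : E m →ₗ[ℝ] Cl m) (u : E m) :
    scalarKernel a w u ∈ Homog m a := by
  have h1 := Homog.rmul_mem (Homog.const_mem (w u)) a
  have h2 := Homog.rmul_mem (Homog.imul_mem (Homog.lin_mem w) u) (a - 2)
  rw [add_zero] at h1
  rw [one_add_one_eq_two, sub_add_cancel] at h2
  exact sub_mem h1 (Submodule.smul_mem _ _ h2)

theorem spinorKernel_mem (a : ℤ) (w : E m →ₗ[ℝ] Cl m) (u : E m) :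
    spinorKernel a w u ∈ Homog m (a + 1) :=
  Homog.vmul_mem (scalarKernel_mem a w u)

end Homogeneity

/-! ### The fundamental solution as a homogeneous smooth function. -/

section FundamentalSolution

variable {m : ℕ}

/-- The function `G_k(x) w(xux/‖x‖²)` of `x`, linear in `u`. -/
def kernelFn (k : ℕ) (w : E m →ₗ[ℝ] Cl m) : E m →ₗ[ℝ] SmoothFn (punctured m) :=
  if Even k then scalarKernel (k - m) w else spinorKernel (k - m - 1) w

theorem scalarKernel_apply (a : ℤ) (w : E m →ₗ[ℝ] Cl m) (u : E m) {x : E m} (hx : x ≠ 0) :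
    (scalarKernel a w u).1 x = ‖x‖ ^ a • w (sandwich x u) := by
  change (rmul a (const (w u))).1 x - (2 : ℝ) • (rmul (a - 2) (imul u (lin w))).1 x = _
  have hn : ‖x‖ ≠ 0 := norm_ne_zero_iff.2 hx
  rw [rmul_apply, rmul_apply, imul_apply, const_apply _ hx, lin_apply _ hx, sandwich, map_sub,
    map_smul, smul_sub, smul_smul, smul_smul, smul_smul, zpow_sub₀ hn]
  congr 2
  field_simp

theorem kernelFn_apply (k : ℕ) (w : E m →ₗ[ℝ] Cl m) (u : E m) {x : E m} (hx : x ≠ 0) :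
    (kernelFn k w u).1 x = G m k x * w (sandwich x u) := by
  unfold kernelFn G
  split_ifs
  · rw [scalarKernel_apply _ w u hx, Algebra.algebraMap_eq_smul_one, smul_mul_assoc, one_mul]
  · rw [spinorKernel, LinearMap.comp_apply, vmul_apply, scalarKernel_apply _ w u hx,
      mul_smul_comm, smul_mul_assoc]

theorem kernelFn_mem (k : ℕ) (w : E m →ₗ[ℝ] Cl m) (u : E m) :
    kernelFn k w u ∈ Homog m (k - m) := by
  unfold kernelFn
  split_ifs
  · exact scalarKernel_mem _ w u
  · simpa using spinorKernel_mem (k - m - 1) w u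

theorem higherSpinEnd_kernelFn {k : ℕ} (hk : 1 ≤ k) (hm : 0 < m) {w : E m →ₗ[ℝ] Cl m}
    (hw : ¬Even k → ∑ i, vec (e i) * w (e i) = 0) (u : E m) :
    higherSpinEnd pd lm k (kernelFn k w) u = 0 := by
  unfold higherSpinEnd kernelFn
  split_ifs with h
  · obtain ⟨n, rfl⟩ := h
    obtain ⟨n, rfl⟩ : ∃ j, n = j + 1 := ⟨n - 1, by omega⟩
    have hn : (n + 1 + (n + 1)) / 2 = n + 1 := by omega
    rw [hn]
    exact bosonicEnd_scalarKernel n hm (by push_cast; ring) w u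
  · obtain ⟨n, rfl⟩ := Nat.not_even_iff_odd.1 h
    have hn : (2 * n + 1 + 1) / 2 = n + 1 := by omega
    rw [hn]
    exact fermionicEnd_spinorKernel (hw h) n hm (by push_cast; ring) u

theorem fundSol_eq (k : ℕ) (c₁ : ℝ) (u v : E m) {x : E m} (hx : x ≠ 0) :
    fundSol m k c₁ (fun u v => kernelLin k v u) x u v =
      (kernelFn k (c₁ • kernelLin k v) u).1 x := by
  rw [kernelFn_apply k _ u hx, fundSol, LinearMap.smul_apply, mul_smul_comm]

end FundamentalSolution

/-! ### Convergence, smoothness and the differential equation for the cotangent series. -/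

section Cotangent

variable {m l : ℕ}

/-- The kernel `G_k(x) w(xux/‖x‖²)` as a decaying function. -/
def decayKernel (k : ℕ) (hlm : l + k + 1 ≤ m) (w : E m →ₗ[ℝ] Cl m) :
    E m →ₗ[ℝ] Decaying m (-(l + 1)) :=
  -- This is where `l ≤ m - k - 1` enters: it says that the degree `k - m` is at most `-(l+1)`.
  (kernelFn k w).codRestrict _ fun u => Homog.decaying (by omega) (kernelFn_mem k w u)

/-- The periodization of the kernel `G_k(x) w(xux/‖x‖²)`. -/
def cotFn (k : ℕ) (hlm : l + k + 1 ≤ m) (w : E m →ₗ[ℝ] Cl m) :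
    E m →ₗ[ℝ] SmoothFn (latticeCompl m l) :=
  periodize (by omega) ∘ₗ decayKernel k hlm w

variable {k : ℕ} (c₁ : ℝ)

theorem represents_cot (hlm : l + k + 1 ≤ m) (v : E m) :
    Represents (fun x u => cot m k l c₁ (fun u v => kernelLin k v u) x u v)
      (cotFn k hlm (c₁ • kernelLin k v)) := by
  intro x hx u
  rw [cotFn, LinearMap.comp_apply, periodize_apply _ _ hx]
  exact tsum_congr fun n => fundSol_eq k c₁ u v (add_latticeVec_mem_punctured hx n)

theorem normallyConvergentOn_fundSol (hlm : l + k + 1 ≤ m) (u v : E m) :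
    NormallyConvergentOn
    (fun (n : Fin l → ℤ) x =>
      fundSol m k c₁ (fun u v => kernelLin k v u) (x + latticeVec m l n) u v)
    (lattice m l : Set (E m))ᶜ := by
  intro K hKs hK
  obtain ⟨M, hM, hb⟩ := exists_summable_bound (by omega)
    (decayKernel k hlm (c₁ • kernelLin k v) u).2 hK hKs
  refine ⟨M, hM, fun n x hx => ?_⟩
  change ‖fundSol m k c₁ (fun u v => kernelLin k v u) (x + latticeVec m l n) u v‖ ≤ M n
  rw [fundSol_eq k c₁ u v (add_latticeVec_mem_punctured (hKs hx) n)]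
  exact hb n x hx

theorem NormallyConvergentOn.hasSumLocallyUniformlyOn {ι X V : Type*}
    [TopologicalSpace X] [LocallyCompactSpace X] [NormedAddCommGroup V] [CompleteSpace V]
    {f : ι → X → V} {Ω : Set X} (hΩ : IsOpen Ω) (hf : NormallyConvergentOn f Ω) :
    HasSumLocallyUniformlyOn f (fun x => ∑' i, f i x) Ω := by
  refine hasSumLocallyUniformlyOn_of_forall_compact hΩ fun K hKs hK => ?_
  obtain ⟨M, hM, hb⟩ := hf K hKs hK
  exact hasSumUniformlyOn_iff_tendstoUniformlyOn.2 (tendstoUniformlyOn_tsum hM hb)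

theorem contDiffOn_cot (hlm : l + k + 1 ≤ m) (v : E m) :
    ContDiffOn ℝ ∞ (fun p : E m × E m => cot m k l c₁ (fun u v => kernelLin k v u) p.1 p.2 v)
      ((lattice m l : Set (E m))ᶜ ×ˢ Set.univ) := by
  -- Linearity in `u` turns joint smoothness into smoothness in `x` of the finitely many functions
  -- at `u = e_i`.
  refine ContDiffOn.congr (f := fun p : E m × E m =>
    ∑ i, p.2 i • (cotFn k hlm (c₁ • kernelLin k v) (e i)).1 p.1) ?_ ?_
  · refine ContDiffOn.sum fun i _ => ContDiffOn.fun_smul ?_ ?_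
    · exact ContDiff.contDiffOn (by fun_prop)
    · exact (cotFn k hlm (c₁ • kernelLin k v) (e i)).2.1.comp contDiffOn_fst fun p hp => hp.1
  · rintro ⟨x, u⟩ ⟨hx, -⟩
    exact (represents_cot c₁ hlm v x hx u).trans
      (sum_smul_map_e (evalAt x ∘ₗ cotFn k hlm (c₁ • kernelLin k v)) u).symm

theorem sum_vec_mul_smul_kernelLin (hm : 0 < m) (hk : ¬Even k) (v : E m) :
    ∑ i, vec (e i) * (c₁ • kernelLin k v) (e i) = 0 := by
  simp only [LinearMap.smul_apply, mul_smul_comm, ← Finset.smul_sum,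
    sum_vec_mul_kernelLin hm hk, smul_zero]

theorem isSpinOne_cot (hlm : l + k + 1 ≤ m) {x : E m} (hx : x ∉ lattice m l) (v : E m) :
    IsSpinOne k fun u => cot m k l c₁ (fun u v => kernelLin k v u) x u v := by
  have h : (fun u => cot m k l c₁ (fun u v => kernelLin k v u) x u v) =
      (evalAt x ∘ₗ cotFn k hlm (c₁ • kernelLin k v)) :=
    funext fun u => represents_cot c₁ hlm v x hx u
  rw [h, isSpinOne_linear_iff]
  intro hk
  -- Monogenicity holds for the unsummed kernel, and periodization commutes with left multiplication
  -- by `e_i`.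
  have h0 : ∑ i, decayLm i (decayKernel k hlm (c₁ • kernelLin k v) (e i)) = 0 := by
    refine Subtype.ext ?_
    rw [AddSubmonoidClass.coe_finsetSum]
    have h1 := sum_lm_spinorKernel
      (sum_vec_mul_smul_kernelLin c₁ (by omega : 0 < m) hk v) (k - m - 1)
    refine Eq.trans ?_ h1
    refine Finset.sum_congr rfl fun i _ => ?_
    change lm i (kernelFn k _ (e i)) = _
    rw [kernelFn, if_neg hk]
  have h2 := congrArg (periodize (by omega : l ≤ m)) h0
  rw [map_zero, map_sum] at h2
  simp only [periodize_lm] at h2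
  have h3 := congrArg (fun f : SmoothFn (latticeCompl m l) => f.1 x) h2
  simp only [coe_sum, lmul_apply] at h3
  exact h3

theorem opE_cot (hlm : l + k + 1 ≤ m) (hk : 1 ≤ k) {x : E m} (hx : x ∉ lattice m l) (u v : E m) :
    opE m k (fun z w => cot m k l c₁ (fun u v => kernelLin k v u) z w v) x u = 0 := by
  rw [(represents_cot c₁ hlm v).opE k x hx u]
  have h := higherSpinEnd_periodize (by omega : l ≤ m) k
    (decayKernel k hlm (c₁ • kernelLin k v)) u
    (higherSpinEnd_kernelFn hk (by omega)
      (fun hk => sum_vec_mul_smul_kernelLin c₁ (by omega) hk v) u)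
  exact congrArg (fun f : SmoothFn (latticeCompl m l) => f.1 x) h

end Cotangent

theorem sub_notMem_lattice {m l : ℕ} {x y : E m} (h : proj m l x ≠ proj m l y) :
    x - y ∉ lattice m l := fun hxy =>
  h (QuotientAddGroup.eq_iff_sub_mem.2 hxy)

end Cylinder
end

/-! ### The main theorem. -/

open Cylinder
theorem mainTheorem1 (m k l : ℕ) (hk : 1 ≤ k) (hl : 1 ≤ l) (hlm : l + k + 1 ≤ m)
    (c₁ : ℝ) (hc : c₁ ≠ 0) :
    (∃! Z : E m → E m → Cl m, IsReproducingKernel m k Z) ∧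
    ∀ Z : E m → E m → Cl m, IsReproducingKernel m k Z →
      -- normal, and locally uniform, convergence on `ℝ^m \ ℤ^l`
      (∀ u v : E m, NormallyConvergentOn
        (fun (n : Fin l → ℤ) x => fundSol m k c₁ Z (x + latticeVec m l n) u v)
        (lattice m l : Set (E m))ᶜ) ∧
      (∀ u v : E m, HasSumLocallyUniformlyOn
        (fun (n : Fin l → ℤ) x => fundSol m k c₁ Z (x + latticeVec m l n) u v)
        (fun x => cot m k l c₁ Z x u v) (lattice m l : Set (E m))ᶜ) ∧
      -- periodicity
      (∀ (n : Fin l → ℤ) (x u v : E m),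
        cot m k l c₁ Z (x + latticeVec m l n) u v = cot m k l c₁ Z x u v) ∧
      -- the sum is smooth, of the right type in `u`, and annihilated by the operator on `ℝ^m`
      (∀ v : E m, ContDiffOn ℝ ∞ (fun p : E m × E m => cot m k l c₁ Z p.1 p.2 v)
        ((lattice m l : Set (E m))ᶜ ×ˢ Set.univ)) ∧
      (∀ x ∉ lattice m l, ∀ v : E m, IsSpinOne k fun u => cot m k l c₁ Z x u v) ∧
      (∀ x ∉ lattice m l, ∀ u v : E m, opE m k (fun z w => cot m k l c₁ Z z w v) x u = 0) ∧
      -- the projected kernel is defined off the diagonal and annihilated by the operator on `C_l`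
      (∀ x y : E m, proj m l x ≠ proj m l y → ∀ u v : E m,
        HasSum (fun n : Fin l → ℤ => fundSol m k c₁ Z (x - y + latticeVec m l n) u v)
          (cotCyl m k l c₁ Z (proj m l x) (proj m l y) u v) ∧
        cotCyl m k l c₁ Z (proj m l x) (proj m l y) u v = cot m k l c₁ Z (x - y) u v) ∧
      (∀ x' y' : Cyl m l, x' ≠ y' → ∀ u v : E m,
        opCyl m k l (fun z w => cotCyl m k l c₁ Z z y' w v) x' u = 0) := by
  have hm : 0 < m := by omega
  refine ⟨⟨_, isReproducingKernel_kernelLin hm k, fun Z hZ => hZ.eq_kernelLin hm⟩, ?_⟩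
  intro Z hZ
  -- Uniqueness replaces an arbitrary reproducing kernel by the explicit one.
  obtain rfl := hZ.eq_kernelLin hm
  have hnc := normallyConvergentOn_fundSol c₁ hlm
  refine ⟨hnc, fun u v => (hnc u v).hasSumLocallyUniformlyOn (isClosed_lattice m l).isOpen_compl,
    fun n x u v => cot_periodic m k l c₁ _ u v n x, contDiffOn_cot c₁ hlm,
    fun x hx v => isSpinOne_cot c₁ hlm hx v, fun x hx u v => opE_cot c₁ hlm hk hx u v,
    fun x y hxy u v => ⟨?_, rfl⟩, ?_⟩
  · obtain ⟨M, hM, hb⟩ := hnc u v {x - y} (Set.singleton_subset_iff.2 (sub_notMem_lattice hxy))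
      isCompact_singleton
    exact (Summable.of_norm_bounded hM fun n => hb n _ rfl).hasSum
  · intro x' y'
    obtain ⟨x, rfl⟩ := QuotientAddGroup.mk_surjective x'
    obtain ⟨y, rfl⟩ := QuotientAddGroup.mk_surjective y'
    intro hxy u v
    -- Lifting to `ℝ^m` turns the projected kernel into the cotangent series translated by `y`.
    refine (opCyl_proj m k l _ x u).trans ?_
    refine (opE_sub m k (fun z w => cot m k l c₁ (fun u v => kernelLin k v u) z w v) x y u).trans ?_
    exact opE_cot c₁ hlm hk (sub_notMem_lattice hxy) u v
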